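/- Let $(\Omega,\mathcal F,\mathbb P^0)$ be a probability space carrying a one-dimensional Brownian motion $W$, let $\sigma>0$, $X_0\in\mathbb R$, $X_t=X_0+\sigma W_t$, and let $\mathbb F=(\mathcal F_t)_{t\ge 0}$ be the (right-continuous) $\mathbb P^0$-augmentation of the filtration generated by $X$. Fix $T>0$, an integer $N\ge 1$, $\gamma>1$, discount rates $r,\rho>0$, a transaction cost rate $k>0$, a maximal effort $\bar a>0$, and an increasing, strictly convex, continuously differentiable $h:[0,\infty)\to[0,\infty)$ with $h(0)=0$. Put $u(x)=x^{1/\gamma}$ and $\delta=r/\rho$. Let $\mathcal A$ be the set of $\mathbb F$-predictable processes $\alpha$ with values in $[0,\bar a]$. For $\alpha\in\mathcal A$ let $\mathbb P^\alpha$ be the probability measure equivalent to $\mathbb P^0$ under which $W_t-\int_0^t \frac{\alpha_s}{\sigma}\,ds$, $t\in[0,T]$, is an $\mathbb F$-Brownian motion. Let $\mathbb C$ be the set of contracts $\mathbf C=(\tau_1,\dots,\tau_N,\xi_1,\dots,\xi_N,\xi_T)$, where $\tau_1\le\dots\le\tau_N$ are $\mathbb F$-stopping times with values in $[0,T)$,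 each $\xi_i\ge0$ is $\mathcal F_{\tau_i}$-measurable, $\xi_T\ge 0$ is $\mathcal F_T$-measurable, and $\max_{i}\sup_{\alpha\in\mathcal A}\big(\mathbb E^{\mathbb P^\alpha}[|\xi_i|^\gamma]+\mathbb E^{\mathbb P^\alpha}[|\xi_T|^\gamma]\big)<\infty$. Let $$J^{A}(\mathbf C,\alpha)=\mathbb E^{\mathbb P^\alpha}\Big[\sum_{i=1}^N e^{-r\tau_i}u(\xi_i)+e^{-rT}u(\xi_T)-\int_0^T re^{-rt}h(\alpha_t)\,dt\Big],$$ $$J^{P}(\mathbf C,\alpha)=\mathbb E^{\mathbb P^\alpha}\Big[-\sum_{i=1}^N e^{-\rho\tau_i}(1+k)\xi_i-e^{-\rho T}\xi_T+\int_0^T\rho e^{-\rho t}\alpha_t\,dt\Big],$$ and, for $R\ge 0$, let $$V^{FB,P}=\sup\{J^P(\mathbf C,\alpha):\ \mathbf C\in\mathbb C,\ \alpha\in\mathcal A,\ J^A(\mathbf C,\alpha)\ge u(R)\}.$$ For $p\le 0$ and $\kappa\ge0$ put $G^*(p)=\sup_{a\in[0,\bar a]}(a+h(a)p)$ and $F^{*,\kappa}(p)=\inf_{y\ge0}(yp+(1+\kappa)y^\gamma)$,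 and for a function $b:(-\infty,0]\to\mathbb R$ put $$D(b)=\inf_{\lambda\le0}\Big\{\lambda u(R)+b(\lambda)-e^{-\rho T}F^{*,0}(\lambda e^{(\rho-r)T})+\int_0^T\rho e^{-\rho t}G^*(\delta\lambda e^{(\rho-r)t})\,dt\Big\}.$$ 1. If $\delta\gamma>1$, then for every $\zeta\in(0,T/N)$, with $t_i=(i-1)\zeta$, $$D\Big(\lambda\mapsto-\sum_{i=1}^N e^{-\rho t_i}F^{*,k}(\lambda e^{(\rho-r)t_i})\Big)\le V^{FB,P}\le D\big(\lambda\mapsto -N F^{*,k}(\lambda)\big).$$ 2. If $\delta\gamma<1$, then for every $\zeta\in(0,T/N)$, with $t_i=T-i\zeta$, $$D\Big(\lambda\mapsto-\sum_{i=1}^N e^{-\rho t_i}F^{*,k}(\lambda e^{(\rho-r)t_i})\Big)\le V^{FB,P}\le D\big(\lambda\mapsto -N e^{-\rho T}F^{*,k}(\lambda e^{(\rho-r)T})\big).$$ 3. If $\delta\gamma=1$, then $$V^{FB,P}=D\big(\lambda\mapsto -N e^{-\rho T}F^{*,k}(\lambda e^{(\rho-r)T})\big).$$ 4. If $R=0$,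 then $0<V^{FB,P}<\bar a\,(1-e^{-\rho T})$. -/

import Mathlib

open MeasureTheory ProbabilityTheory Set
open scoped NNReal ENNReal

/-- The primitives of the principal-agent model: a probability space `(Ω, 𝓐, P)` carrying a
one-dimensional Brownian motion `W`, and the parameters with their standing assumptions. -/
structure PAModel (Ω : Type*) [MeasurableSpace Ω] where
  /-- reference measure -/
  P : Measure Ω
  isProb : IsProbabilityMeasure P
  /-- driving Brownian motion -/
  W : ℝ≥0 → Ω → ℝ
  measurable_W : ∀ t, Measurable (W t)
  brownian_W : IsBrownianReal W P
  /-- initial output -/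
  X₀ : ℝ
  /-- volatility -/
  σ : ℝ
  σ_pos : 0 < σ
  /-- horizon -/
  T : ℝ≥0
  T_pos : 0 < T
  /-- number of bonus payments -/
  N : ℕ
  one_le_N : 1 ≤ N
  /-- utility exponent: `u x = x ^ (1 / γ)` -/
  γ : ℝ
  one_lt_γ : 1 < γ
  /-- the agent's discount rate -/
  r : ℝ
  r_pos : 0 < r
  /-- the principal's discount rate -/
  ρ : ℝ
  ρ_pos : 0 < ρ
  /-- transaction cost rate of a bonus payment -/
  k : ℝ
  k_pos : 0 < k
  /-- maximal effort -/
  abar : ℝ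
  abar_pos : 0 < abar
  /-- cost of effort, used only on `[0, ∞)` -/
  h : ℝ → ℝ
  h_mono : MonotoneOn h (Ici 0)
  h_strictConvex : StrictConvexOn ℝ (Ici 0) h
  h_contDiff : ContDiffOn ℝ 1 h (Ici 0)
  h_zero : h 0 = 0

/-- The augmentation of a filtration by the `P`-null events, made right-continuous. -/
noncomputable def augmentation {Ω : Type*} [m : MeasurableSpace Ω]
    (𝓖 : Filtration ℝ≥0 m) (P : Measure Ω) : Filtration ℝ≥0 m :=
  Filtration.rightCont
    { seq := fun t => 𝓖 t ⊔ MeasurableSpace.generateFrom {A | MeasurableSet A ∧ P A = 0}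
      mono' := fun _ _ hst => sup_le_sup_right (𝓖.mono hst) _
      le' := fun t => sup_le (𝓖.le t) (MeasurableSpace.generateFrom_le fun _ hA => hA.1) }

/-- `B` is, on `[0, T]`, a standard one-dimensional Brownian motion with respect to the
filtration `𝓕` under the measure `Q`. -/
structure IsBrownianOn {Ω : Type*} [m : MeasurableSpace Ω] (𝓕 : Filtration ℝ≥0 m)
    (Q : Measure Ω) (T : ℝ≥0) (B : ℝ≥0 → Ω → ℝ) : Prop where
  adapted : ∀ t ≤ T, Measurable[𝓕 t] (B t)
  zero : ∀ᵐ ω ∂Q, B 0 ω = 0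
  cont : ∀ᵐ ω ∂Q, ContinuousOn (fun t => B t ω) (Icc 0 T)
  indep : ∀ s t, s ≤ t → t ≤ T →
    Indep (MeasurableSpace.comap (fun ω => B t ω - B s ω) inferInstance) (𝓕 s) Q
  law : ∀ s t, s ≤ t → t ≤ T →
    HasLaw (fun ω => B t ω - B s ω) (gaussianReal 0 (t - s)) Q

/-- The data of a contract: `N` bonus times, `N` bonus payments and a terminal payment. -/
structure Contract (N : ℕ) (Ω : Type*) where
  τ : Fin N → Ω → ℝ≥0
  ξ : Fin N → Ω → ℝ
  ξT : Ω → ℝ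

namespace PAModel

variable {Ω : Type*} [m : MeasurableSpace Ω] (M : PAModel Ω)

/-- Relative discounting. -/
noncomputable def δ : ℝ := M.r / M.ρ

/-- The agent's utility function. -/
noncomputable def u (x : ℝ) : ℝ := x ^ (1 / M.γ)

/-- The output process `X = X₀ + σ W`. -/
def X (t : ℝ≥0) (ω : Ω) : ℝ := M.X₀ + M.σ * M.W t ω

lemma measurable_X (t : ℝ≥0) : Measurable (M.X t) :=
  ((M.measurable_W t).const_mul M.σ).const_add M.X₀

/-- The augmented filtration generated by the output. -/
noncomputable def 𝓕 : Filtration ℝ≥0 m :=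
  augmentation (Filtration.natural M.X fun t => (M.measurable_X t).stronglyMeasurable) M.P

/-- Effort processes: predictable processes with values in `[0, abar]`. -/
def Effort (α : ℝ≥0 → Ω → ℝ) : Prop :=
  IsStronglyPredictable M.𝓕 α ∧ ∀ t ω, α t ω ∈ Icc 0 M.abar

/-- `W^α = W - ∫ α / σ`. -/
noncomputable def Wα (α : ℝ≥0 → Ω → ℝ) (t : ℝ≥0) (ω : Ω) : ℝ :=
  M.W t ω - ∫ s in (0 : ℝ)..t, α s.toNNReal ω / M.σ

/-- `Q` is the measure `ℙ^α` induced by the effort `α`: it is equivalent to the reference measure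
and `W^α` is a Brownian motion under `Q`. (This determines `Q` on `𝓕 T`.) -/
structure IsEffortMeasure (α : ℝ≥0 → Ω → ℝ) (Q : Measure Ω) : Prop where
  isProb : IsProbabilityMeasure Q
  ac : Q ≪ M.P
  ac' : M.P ≪ Q
  brownian : IsBrownianOn M.𝓕 Q M.T (M.Wα α)

/-- Admissible contracts. -/
structure Admissible (C : Contract M.N Ω) : Prop where
  stopping : ∀ i, IsStoppingTime M.𝓕 (fun ω => (C.τ i ω : WithTop ℝ≥0))
  lt_T : ∀ i ω, C.τ i ω < M.T
  increasing : ∀ ω, Monotone fun i => C.τ i ω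
  ξ_nonneg : ∀ i ω, 0 ≤ C.ξ i ω
  ξ_meas : ∀ i, Measurable[(stopping i).measurableSpace] (C.ξ i)
  ξT_nonneg : ∀ ω, 0 ≤ C.ξT ω
  ξT_meas : Measurable[M.𝓕 M.T] C.ξT
  integrability :
    (⨆ (i : Fin M.N) (α : ℝ≥0 → Ω → ℝ) (Q : Measure Ω)
        (_ : M.Effort α) (_ : M.IsEffortMeasure α Q),
      ((∫⁻ ω, ENNReal.ofReal (|C.ξ i ω| ^ M.γ) ∂Q) +
        ∫⁻ ω, ENNReal.ofReal (|C.ξT ω| ^ M.γ) ∂Q)) < ∞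

/-- The agent's objective `J^A(C, α)`, the expectation being taken under `Q = ℙ^α`. -/
noncomputable def JA (C : Contract M.N Ω) (α : ℝ≥0 → Ω → ℝ) (Q : Measure Ω) : ℝ :=
  ∫ ω, ((∑ i, Real.exp (-M.r * C.τ i ω) * M.u (C.ξ i ω))
    + Real.exp (-M.r * M.T) * M.u (C.ξT ω)
    - ∫ t in (0 : ℝ)..M.T, M.r * Real.exp (-M.r * t) * M.h (α t.toNNReal ω)) ∂Q

/-- The principal's objective `J^P(C, α)`, the expectation being taken under `Q = ℙ^α`. -/
noncomputable def JP (C : Contract M.N Ω) (α : ℝ≥0 → Ω → ℝ) (Q : Measure Ω) : ℝ :=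
  ∫ ω, (-(∑ i, Real.exp (-M.ρ * C.τ i ω) * ((1 + M.k) * C.ξ i ω))
    - Real.exp (-M.ρ * M.T) * C.ξT ω
    + ∫ t in (0 : ℝ)..M.T, M.ρ * Real.exp (-M.ρ * t) * α t.toNNReal ω) ∂Q

/-- The principal's first-best value at reservation level `R`. -/
noncomputable def VFB (R : ℝ) : EReal :=
  sSup {v : EReal | ∃ (C : Contract M.N Ω) (α : ℝ≥0 → Ω → ℝ) (Q : Measure Ω),
    M.Admissible C ∧ M.Effort α ∧ M.IsEffortMeasure α Q ∧ M.u R ≤ M.JA C α Q ∧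
    v = (M.JP C α Q : EReal)}

/-- `F y = - u⁻¹ y = - y ^ γ`. -/
noncomputable def F (y : ℝ) : ℝ := -y ^ M.γ

/-- The concave conjugate `F^{*,κ}`. -/
noncomputable def Fstar (κ p : ℝ) : ℝ :=
  sInf ((fun y => y * p - (1 + κ) * M.F y) '' Ici 0)

/-- The convex dual `G^*` of the cost of effort. -/
noncomputable def Gstar (p : ℝ) : ℝ :=
  sSup ((fun a => a + M.h a * p) '' Icc 0 M.abar)

/-- `inf_{l ≤ 0} { l u(R) + b(l) - e^{-ρT} F^{*,0}(l e^{(ρ-r)T})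
  + ∫_0^T ρ e^{-ρt} G^*(δ l e^{(ρ-r)t}) dt }`, where `b(l)` is the contribution of the bonuses. -/
noncomputable def dualInf (R : ℝ) (b : ℝ → ℝ) : EReal :=
  ⨅ (l : ℝ) (_ : l ≤ 0),
    ((l * M.u R + b l
      - Real.exp (-M.ρ * M.T) * M.Fstar 0 (l * Real.exp ((M.ρ - M.r) * M.T))
      + ∫ t in (0 : ℝ)..M.T, M.ρ * Real.exp (-M.ρ * t) *
          M.Gstar (M.δ * l * Real.exp ((M.ρ - M.r) * t)) : ℝ) : EReal)

/-- The bonus contribution `- e^{-ρs} F^{*,k}(l e^{(ρ-r)s})` of one payment at time `s`. -/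
noncomputable def bonus (s l : ℝ) : ℝ :=
  -(Real.exp (-M.ρ * s) * M.Fstar M.k (l * Real.exp ((M.ρ - M.r) * s)))

end PAModel

/-! Lagrangian duality for the participation constraint. For a multiplier `l ≤ 0`, the integrand of
`JP` minus `l` times that of `JA` is bounded path by path: a payment contributes at most its
`-Fstar` term, effort at most `Gstar`. Taking expectations and using `l ≤ 0` gives weak duality
(`VFB_le`). By homogeneity (`exists_bonus_eq`) a bonus at time `s` is worth `c (-l)^γ' exp
(bonusRate * s)`, where `bonusRate` has the sign of `1 - δγ`. The best time is thus `0`, `T` or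
arbitrary, and this gives the three upper bounds.

For the lower bounds, payment dates are fixed and deterministic. The pointwise optimizers of the
Lagrangian are deterministic and continuous in `l`, so the intermediate value theorem provides a
multiplier at which participation binds (`exists_slack_eq_zero`); there the dual function equals the
principal's payoff (`dual_eq_of_slack_eq_zero`). That payoff must be reached by an effort for which
`ℙ^α` is known to exist. Girsanov's theorem is proved for deterministic step drifts only, so the
optimal effort is approximated by steps and a small extra terminal payment restores participation.

For `R = 0` both strict bounds compare a linear term with a power of exponent greater than `1` near
`0`. -/

/-! ### Gaussian increments through characteristic functions. -/

/-- If the restriction of `Q` to every event of `𝓖` sees `X` with the Gaussian characteristic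
function, then `X` is Gaussian and independent of `𝓖`. -/
lemma indep_and_hasLaw_of_setIntegral_cexp {Ω : Type*} {𝓖 : MeasurableSpace Ω}
    [m : MeasurableSpace Ω] {Q : Measure Ω} [IsProbabilityMeasure Q]
    {X : Ω → ℝ} (hX : Measurable X) {v : ℝ≥0}
    (H : ∀ A, MeasurableSet[𝓖] A → ∀ θ : ℝ,
      ∫ ω in A, Complex.exp (θ * X ω * Complex.I) ∂Q
        = Q.real A * Complex.exp (-(v * θ ^ 2 / 2))) :
    Indep (MeasurableSpace.comap X inferInstance) 𝓖 Q ∧ HasLaw X (gaussianReal 0 v) Q := by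
  -- Both sides are finite measures, so equal characteristic functions suffice. `A = univ` yields
  -- the law; evaluating at a Borel set yields the product formula.
  have key : ∀ A, MeasurableSet[𝓖] A → (Q.restrict A).map X = Q A • gaussianReal 0 v := by
    intro A hA
    have : IsFiniteMeasure (Q A • gaussianReal 0 v) := by
      refine ⟨?_⟩
      simp
    refine Measure.ext_of_charFun (funext fun θ => ?_)
    rw [charFun_apply_real, integral_map hX.aemeasurable (by fun_prop), H A hA θ,
      charFun_apply_real, integral_smul_measure, ← charFun_apply_real, charFun_gaussianReal]
    simp [Measure.real]
  have hlaw : Q.map X = gaussianReal 0 v := by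
    simpa using key univ MeasurableSet.univ
  refine ⟨?_, ⟨hX.aemeasurable, hlaw⟩⟩
  rw [Indep_iff]
  rintro _ A ⟨S, hS, rfl⟩ hA
  have h1 := congrArg (fun μ : Measure ℝ => μ S) (key A hA)
  simp only [Measure.smul_apply, smul_eq_mul] at h1
  rw [Measure.map_apply hX hS, Measure.restrict_apply (hX hS), ← hlaw,
    Measure.map_apply hX hS] at h1
  rw [h1, mul_comm]

/-! ### The augmented filtration, and `W` as a Brownian motion for it. -/

section Augmentation

variable {Ω : Type*} {𝓗 : MeasurableSpace Ω} [m : MeasurableSpace Ω]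

lemma augmentation_le_sup (𝓖 : Filtration ℝ≥0 m) (P : Measure Ω) {s t : ℝ≥0} (hst : s < t) :
    augmentation 𝓖 P s
      ≤ 𝓖 t ⊔ MeasurableSpace.generateFrom {A | MeasurableSet A ∧ P A = 0} := by
  rw [augmentation, Filtration.rightCont_eq]
  exact iInf₂_le t hst

lemma le_augmentation (𝓖 : Filtration ℝ≥0 m) (P : Measure Ω) (t : ℝ≥0) :
    𝓖 t ≤ augmentation 𝓖 P t :=
  le_trans (le_sup_left (b := MeasurableSpace.generateFrom {A | MeasurableSet A ∧ P A = 0}))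
    (Filtration.le_rightCont
      { seq := fun t => 𝓖 t ⊔ MeasurableSpace.generateFrom {A | MeasurableSet A ∧ P A = 0}
        mono' := fun _ _ hst => sup_le_sup_right (𝓖.mono hst) _
        le' := fun t => sup_le (𝓖.le t) (MeasurableSpace.generateFrom_le fun _ hA => hA.1) } t)

/-- The sets almost everywhere equal to an `𝓗`-measurable one form a σ-algebra containing `𝓗` and
the null sets. -/
lemma exists_ae_eq_of_measurableSet_sup_null {P : Measure Ω} {A : Set Ω}
    (hA : MeasurableSet[𝓗 ⊔ MeasurableSpace.generateFrom {A | MeasurableSet A ∧ P A = 0}] A) :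
    ∃ A', MeasurableSet[𝓗] A' ∧ A =ᵐ[P] A' := by
  have hle : 𝓗 ⊔ MeasurableSpace.generateFrom {A | MeasurableSet A ∧ P A = 0}
      ≤ eventuallyMeasurableSpace 𝓗 (ae P) := by
    refine sup_le (fun A hA => ⟨A, hA, Filter.EventuallyEq.refl _ _⟩) (MeasurableSpace.generateFrom_le ?_)
    rintro B ⟨-, hB⟩
    exact ⟨∅, @MeasurableSet.empty _ 𝓗, ae_eq_empty.2 hB⟩
  exact hle A hA

end Augmentation

namespace PAModel

variable {Ω : Type*} [m : MeasurableSpace Ω] (M : PAModel Ω)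

lemma natural_X_le (t : ℝ≥0) :
    Filtration.natural M.X (fun t => (M.measurable_X t).stronglyMeasurable) t
      ≤ MeasurableSpace.comap (fun ω (j : Iic t) => M.W j ω) inferInstance := by
  refine iSup₂_le fun j hj => ?_
  rintro _ ⟨S, hS, rfl⟩
  refine ⟨(fun f : Iic t → ℝ => M.X₀ + M.σ * f ⟨j, hj⟩) ⁻¹' S, ?_, rfl⟩
  exact measurableSet_preimage (by fun_prop) hS

lemma measurable_W_𝓕 (t : ℝ≥0) : Measurable[M.𝓕 t] (M.W t) := by
  have h1 : Measurable[M.𝓕 t] (M.X t) := by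
    have := (Filtration.stronglyAdapted_natural
      (fun t => (M.measurable_X t).stronglyMeasurable) t).measurable
    exact this.mono (le_augmentation _ _ _) le_rfl
  have h2 : M.W t = fun ω => (M.X t ω - M.X₀) / M.σ := by
    funext ω
    simp [X, M.σ_pos.ne']
  rw [h2]
  exact (h1.sub_const _).div_const _

lemma indep_increment_natural {s t : ℝ≥0} (hst : s ≤ t) :
    Indep (MeasurableSpace.comap (fun ω => M.W t ω - M.W s ω) inferInstance)
      (MeasurableSpace.comap (fun ω (j : Iic s) => M.W j ω) inferInstance) M.P := by
  have h := (M.brownian_W.toIsPreBrownianReal.indepFun_shift s)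
  rw [IndepFun_iff_Indep] at h
  refine indep_of_indep_of_le_left h ?_
  rintro _ ⟨S, hS, rfl⟩
  refine ⟨(fun f : ℝ≥0 → ℝ => f (t - s)) ⁻¹' S, ?_, ?_⟩
  · exact measurableSet_preimage (by fun_prop) hS
  · ext ω
    simp [add_tsub_cancel_of_le hst]

lemma hasLaw_increment {s t : ℝ≥0} (hst : s ≤ t) :
    HasLaw (fun ω => M.W t ω - M.W s ω) (gaussianReal 0 (t - s)) M.P := by
  have h := M.brownian_W.toIsPreBrownianReal.hasLaw_sub t s
  have : nndist t.1 s.1 = t - s := by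
    ext
    have h : (s : ℝ) ≤ t := hst
    rw [coe_nndist, NNReal.coe_sub hst]
    exact abs_of_nonneg (sub_nonneg.2 h)
  rw [this] at h
  exact h

/-- The strict gap `q < s` absorbs the right limit in the augmentation: `A` agrees almost surely
with an event of the natural filtration at `s`, which is independent of the increment. -/
lemma setIntegral_cexp_increment {q s t : ℝ≥0} (hq : q < s) (hst : s ≤ t) {A : Set Ω}
    (hA : MeasurableSet[M.𝓕 q] A) (θ : ℝ) :
    ∫ ω in A, Complex.exp (θ * (M.W t ω - M.W s ω : ℝ) * Complex.I) ∂M.P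
      = M.P.real A * Complex.exp (-((t - s : ℝ≥0) * θ ^ 2 / 2)) := by
  have := M.isProb
  obtain ⟨A', hA', hAA'⟩ := exists_ae_eq_of_measurableSet_sup_null
    (augmentation_le_sup _ _ hq _ hA)
  have hmA' : MeasurableSet A' := (Filtration.le _ _) _ hA'
  rw [setIntegral_congr_set hAA', measureReal_congr hAA']
  have hmeas : Measurable (fun ω => M.W t ω - M.W s ω) := (M.measurable_W t).sub (M.measurable_W s)
  have hind : IndepFun (A'.indicator (fun _ => (1 : ℂ)))
      (fun ω => Complex.exp (θ * (M.W t ω - M.W s ω : ℝ) * Complex.I)) M.P := by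
    have h1 := (M.indep_increment_natural hst).symm
    refine indep_of_indep_of_le_left (indep_of_indep_of_le_right h1 ?_) ?_
    · rintro _ ⟨S, hS, rfl⟩
      exact ⟨(fun x : ℝ => Complex.exp (θ * x * Complex.I)) ⁻¹' S,
        measurableSet_preimage (by fun_prop) hS, rfl⟩
    · have : Measurable[MeasurableSpace.comap (fun ω (j : Iic s) => M.W j ω) inferInstance]
          (A'.indicator (fun _ => (1 : ℂ))) :=
        measurable_const.indicator (M.natural_X_le s _ hA')
      exact this.comap_le
  have h2 := hind.integral_mul_eq_mul_integral
    ((measurable_const.indicator hmA').aestronglyMeasurable)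
    (Measurable.aestronglyMeasurable (by fun_prop))
  have h3 : ∫ ω, Complex.exp (θ * (M.W t ω - M.W s ω : ℝ) * Complex.I) ∂M.P
      = Complex.exp (-((t - s : ℝ≥0) * θ ^ 2 / 2)) := by
    have h4 := charFun_gaussianReal (μ := 0) (v := t - s) θ
    rw [← (M.hasLaw_increment hst).map_eq, charFun_apply_real,
      integral_map hmeas.aemeasurable (by fun_prop)] at h4
    rw [h4]
    simp
  rw [h3, integral_indicator_const _ hmA'] at h2
  rw [← integral_indicator hmA']
  convert h2 using 1
  · congr 1
    funext ω
    by_cases h : ω ∈ A' <;> simp [h]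
  · simp

/-- The driving Brownian motion is a Brownian motion for the augmented filtration. -/
lemma isBrownianOn_W : IsBrownianOn M.𝓕 M.P M.T M.W := by
  have := M.isProb
  have key : ∀ s t : ℝ≥0, s ≤ t → ∀ A, MeasurableSet[M.𝓕 s] A → ∀ θ : ℝ,
      ∫ ω in A, Complex.exp (θ * (M.W t ω - M.W s ω : ℝ) * Complex.I) ∂M.P
        = M.P.real A * Complex.exp (-((t - s : ℝ≥0) * θ ^ 2 / 2)) := by
    intro s t hst A hA θ
    -- Shifting both times by `ε n` creates the strict gap and leaves the length of the increment
    -- unchanged; path continuity and dominated convergence remove the shift.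
    let ε : ℕ → ℝ≥0 := fun n => 1 / ((n : ℝ≥0) + 1)
    have hε : Filter.Tendsto ε Filter.atTop (nhds 0) := tendsto_one_div_add_atTop_nhds_zero_nat
    have hlim : Filter.Tendsto (fun n => ∫ ω in A,
        Complex.exp (θ * (M.W (t + ε n) ω - M.W (s + ε n) ω : ℝ) * Complex.I) ∂M.P)
        Filter.atTop
        (nhds (∫ ω in A, Complex.exp (θ * (M.W t ω - M.W s ω : ℝ) * Complex.I) ∂M.P)) := by
      refine tendsto_integral_of_dominated_convergence (fun _ => 1) ?_ (by simp) ?_ ?_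
      · intro n
        have h1 := M.measurable_W (t + ε n)
        have h2 := M.measurable_W (s + ε n)
        fun_prop
      · intro n
        refine Filter.Eventually.of_forall fun ω => ?_
        rw [← Complex.ofReal_mul, Complex.norm_exp_ofReal_mul_I]
      · filter_upwards [ae_restrict_of_ae M.brownian_W.cont] with ω hω
        have h1 : Filter.Tendsto (fun n => M.W (t + ε n) ω) Filter.atTop (nhds (M.W t ω)) := by
          have : Filter.Tendsto (fun n => t + ε n) Filter.atTop (nhds t) := by
            simpa using hε.const_add t
          exact (hω.tendsto t).comp this
        have h2 : Filter.Tendsto (fun n => M.W (s + ε n) ω) Filter.atTop (nhds (M.W s ω)) := by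
          have : Filter.Tendsto (fun n => s + ε n) Filter.atTop (nhds s) := by
            simpa using hε.const_add s
          exact (hω.tendsto s).comp this
        have hc : Continuous fun x : ℝ => Complex.exp (θ * (x : ℂ) * Complex.I) := by fun_prop
        exact (hc.tendsto _).comp (h1.sub h2)
    refine tendsto_nhds_unique hlim ?_
    refine tendsto_const_nhds.congr fun n => ?_
    have hpos : 0 < ε n := by positivity
    rw [M.setIntegral_cexp_increment (lt_add_of_pos_right s hpos)
      (add_le_add_left hst (ε n)) hA θ, add_tsub_add_eq_tsub_right]
  refine ⟨fun t _ => M.measurable_W_𝓕 t, M.brownian_W.eval_zero_ae_eq_zero, ?_, ?_, ?_⟩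
  · filter_upwards [M.brownian_W.cont] with ω hω using hω.continuousOn
  · intro s t hst _
    exact (indep_and_hasLaw_of_setIntegral_cexp
      ((M.measurable_W t).sub (M.measurable_W s)) (key s t hst)).1
  · intro s t hst _
    exact (indep_and_hasLaw_of_setIntegral_cexp
      ((M.measurable_W t).sub (M.measurable_W s)) (key s t hst)).2

end PAModel

/-! ### Girsanov's theorem for deterministic step drifts. -/

namespace IsBrownianOn

/-- The exponential density that adds the drift `a` from time `u` on. -/
noncomputable def density {Ω : Type*} (B : ℝ≥0 → Ω → ℝ) (T : ℝ≥0) (a : ℝ) (u : ℝ≥0) (ω : Ω) : ℝ :=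
  Real.exp (a * (B T ω - B u ω) - (T - u) * a ^ 2 / 2)

/-- In complex form, the real tilt and the characteristic function are both handled by
`integral_mul_cexp`. -/
lemma coe_density {Ω : Type*} (B : ℝ≥0 → Ω → ℝ) (T : ℝ≥0) (a : ℝ) (u : ℝ≥0) (ω : Ω) :
    (density B T a u ω : ℂ) = Complex.exp (a * (B T ω - B u ω : ℝ))
      * Complex.exp (-((T - u : ℝ) * (a : ℂ) ^ 2 / 2)) := by
  rw [density, ← Complex.exp_add]
  push_cast
  ring_nf

variable {Ω : Type*} [m : MeasurableSpace Ω] {𝓕 : Filtration ℝ≥0 m} {Q : Measure Ω} {T : ℝ≥0}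
  {B : ℝ≥0 → Ω → ℝ}

lemma measurable (hB : IsBrownianOn 𝓕 Q T B) {t : ℝ≥0} (ht : t ≤ T) : Measurable (B t) :=
  (hB.adapted t ht).mono (𝓕.le t) le_rfl

lemma measurable_mul_cexp (hB : IsBrownianOn 𝓕 Q T B) {s t : ℝ≥0} (hst : s ≤ t)
    (ht : t ≤ T) {f : Ω → ℂ} (hf : Measurable[𝓕 s] f) (z : ℂ) :
    Measurable[𝓕 t] fun ω => f ω * Complex.exp (z * (B t ω - B s ω : ℝ)) := by
  have h1 := hB.adapted t ht
  have h2 := (hB.adapted s (hst.trans ht)).mono (𝓕.mono hst) le_rfl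
  exact (hf.mono (𝓕.mono hst) le_rfl).mul
    (Complex.measurable_exp.comp ((Complex.measurable_ofReal.comp (h1.sub h2)).const_mul z))

/-- Complex exponential moments of an increment, conditionally on the past. -/
lemma integral_mul_cexp (hB : IsBrownianOn 𝓕 Q T B) {s t : ℝ≥0} (hst : s ≤ t) (ht : t ≤ T)
    {f : Ω → ℂ} (hf : Measurable[𝓕 s] f) (z : ℂ) :
    ∫ ω, f ω * Complex.exp (z * (B t ω - B s ω : ℝ)) ∂Q
      = (∫ ω, f ω ∂Q) * Complex.exp ((t - s : ℝ) * z ^ 2 / 2) := by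
  have hmeas : Measurable fun ω => B t ω - B s ω :=
    (hB.measurable ht).sub (hB.measurable (hst.trans ht))
  have hind : IndepFun f (fun ω => Complex.exp (z * (B t ω - B s ω : ℝ))) Q := by
    refine indep_of_indep_of_le_left (indep_of_indep_of_le_right (hB.indep s t hst ht).symm ?_) ?_
    · rintro _ ⟨S, hS, rfl⟩
      exact ⟨(fun x : ℝ => Complex.exp (z * x)) ⁻¹' S,
        measurableSet_preimage (by fun_prop) hS, rfl⟩
    · exact hf.comap_le
  -- The product formula for independent functions requires no integrability, hence none is asked of
  -- `f`.
  have h := hind.integral_mul_eq_mul_integral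
    (hf.mono (𝓕.le s) le_rfl).aestronglyMeasurable
    (Measurable.aestronglyMeasurable (by fun_prop))
  have h' := complexMGF_gaussianReal (hB.law s t hst ht).map_eq z
  rw [complexMGF] at h'
  refine h.trans ?_
  rw [h']
  congr 2
  rw [NNReal.coe_sub hst]
  simp

lemma measurable_density (hB : IsBrownianOn 𝓕 Q T B) (a : ℝ) {u : ℝ≥0} (hu : u ≤ T) :
    Measurable (density B T a u) := by
  have h1 := hB.measurable le_rfl
  have h2 := hB.measurable hu
  unfold density
  fun_prop

/-- Increments under the tilted measure, against an `𝓕 s`-measurable function. -/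
lemma integral_density_mul (hB : IsBrownianOn 𝓕 Q T B) (a : ℝ) {u s t : ℝ≥0} (hu : u ≤ T)
    (hst : s ≤ t) (ht : t ≤ T) {f : Ω → ℂ} (hf : Measurable[𝓕 s] f) (θ : ℝ) :
    ∫ ω, (density B T a u ω : ℂ) * (f ω * Complex.exp (θ * Complex.I *
        ((B t ω - a * (t - u : ℝ≥0)) - (B s ω - a * (s - u : ℝ≥0)) : ℝ))) ∂Q
      = (∫ ω, (density B T a u ω : ℂ) * f ω ∂Q) * Complex.exp (-((t - s : ℝ) * θ ^ 2 / 2)) := by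
  have hI : Complex.I ^ 2 = -1 := Complex.I_sq
  -- Three positions of `u` relative to `s ≤ t`. In each, the exponent is split over consecutive
  -- intervals and the increments are integrated out from the latest to the earliest. The
  -- coefficient is `θ i` before `u`, `a` when only the tilt is present, and `a + θ i` on the part
  -- of `[s, t]` after `u`.
  rcases le_total t u with htu | hut
  · have hsu := hst.trans htu
    have e1 : ∀ ω, (density B T a u ω : ℂ) * (f ω * Complex.exp (θ * Complex.I *
        ((B t ω - a * (t - u : ℝ≥0)) - (B s ω - a * (s - u : ℝ≥0)) : ℝ)))
        = Complex.exp (-((T - u : ℝ) * (a : ℂ) ^ 2 / 2)) *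
          ((f ω * Complex.exp (θ * Complex.I * (B t ω - B s ω : ℝ))) *
            Complex.exp (a * (B T ω - B u ω : ℝ))) := by
      intro ω
      rw [coe_density, tsub_eq_zero_of_le htu, tsub_eq_zero_of_le hsu]
      simp only [NNReal.coe_zero, mul_zero, sub_zero]
      ring
    have e2 : ∀ ω, (density B T a u ω : ℂ) * f ω
        = Complex.exp (-((T - u : ℝ) * (a : ℂ) ^ 2 / 2)) *
          (f ω * Complex.exp (a * (B T ω - B u ω : ℝ))) := by
      intro ω
      rw [coe_density]
      ring
    simp_rw [e1, e2, integral_const_mul]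
    rw [hB.integral_mul_cexp hu le_rfl
        ((hB.measurable_mul_cexp hst ht hf _).mono (𝓕.mono htu) le_rfl),
      hB.integral_mul_cexp hu le_rfl (hf.mono (𝓕.mono hsu) le_rfl),
      hB.integral_mul_cexp hst ht hf]
    have : (t - s : ℝ) * (θ * Complex.I) ^ 2 / 2 = -((t - s : ℝ) * (θ : ℂ) ^ 2 / 2) := by
      rw [mul_pow, hI]; ring
    rw [this]
    push_cast
    ring
  rcases le_total s u with hsu | hus
  · have e1 : ∀ ω, (density B T a u ω : ℂ) * (f ω * Complex.exp (θ * Complex.I *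
        ((B t ω - a * (t - u : ℝ≥0)) - (B s ω - a * (s - u : ℝ≥0)) : ℝ)))
        = Complex.exp (-((T - u : ℝ) * (a : ℂ) ^ 2 / 2) - θ * Complex.I * (a * (t - u : ℝ))) *
          (((f ω * Complex.exp (θ * Complex.I * (B u ω - B s ω : ℝ))) *
            Complex.exp ((a + θ * Complex.I) * (B t ω - B u ω : ℝ))) *
            Complex.exp (a * (B T ω - B t ω : ℝ))) := by
      intro ω
      rw [coe_density, tsub_eq_zero_of_le hsu, NNReal.coe_sub hut]
      rw [show ∀ x y z w v : ℂ, x * (((w * y) * z) * v) = w * (x * y * z * v) by intros; ring,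
        show ∀ x y z w : ℂ, x * y * (z * w) = z * (x * y * w) by intros; ring]
      simp only [← Complex.exp_add]
      congr 2
      push_cast
      ring
    have e2 : ∀ ω, (density B T a u ω : ℂ) * f ω
        = Complex.exp (-((T - u : ℝ) * (a : ℂ) ^ 2 / 2)) *
          (f ω * Complex.exp (a * (B T ω - B u ω : ℝ))) := by
      intro ω
      rw [coe_density]
      ring
    have hm1 := hB.measurable_mul_cexp hsu hu hf (θ * Complex.I)
    simp_rw [e1, e2, integral_const_mul]
    rw [hB.integral_mul_cexp ht le_rfl (hB.measurable_mul_cexp hut ht hm1 _),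
      hB.integral_mul_cexp hut ht hm1, hB.integral_mul_cexp hsu hu hf,
      hB.integral_mul_cexp hu le_rfl (hf.mono (𝓕.mono hsu) le_rfl)]
    -- The cross term `2 a θ i` of `(a + θ i)^2` cancels the factor coming from the subtracted
    -- drift.
    rw [show ∀ x y z w v : ℂ, x * (((w * y) * z) * v) = w * (x * y * z * v) by intros; ring,
      show ∀ x y z w : ℂ, x * (w * y) * z = w * (x * y * z) by intros; ring]
    simp only [← Complex.exp_add]
    congr 2
    push_cast
    ring_nf
    rw [hI]
    ring
  · have e1 : ∀ ω, (density B T a u ω : ℂ) * (f ω * Complex.exp (θ * Complex.I *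
        ((B t ω - a * (t - u : ℝ≥0)) - (B s ω - a * (s - u : ℝ≥0)) : ℝ)))
        = Complex.exp (-((T - u : ℝ) * (a : ℂ) ^ 2 / 2) - θ * Complex.I * (a * (t - s : ℝ))) *
          (((f ω * Complex.exp (a * (B s ω - B u ω : ℝ))) *
            Complex.exp ((a + θ * Complex.I) * (B t ω - B s ω : ℝ))) *
            Complex.exp (a * (B T ω - B t ω : ℝ))) := by
      intro ω
      rw [coe_density, NNReal.coe_sub hus, NNReal.coe_sub hut]
      rw [show ∀ x y z w v : ℂ, x * (((w * y) * z) * v) = w * (x * y * z * v) by intros; ring,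
        show ∀ x y z w : ℂ, x * y * (z * w) = z * (x * y * w) by intros; ring]
      simp only [← Complex.exp_add]
      congr 2
      push_cast
      ring
    have e2 : ∀ ω, (density B T a u ω : ℂ) * f ω
        = Complex.exp (-((T - u : ℝ) * (a : ℂ) ^ 2 / 2)) *
          ((f ω * Complex.exp (a * (B s ω - B u ω : ℝ))) *
            Complex.exp (a * (B T ω - B s ω : ℝ))) := by
      intro ω
      rw [coe_density, show ∀ x y z w : ℂ, x * (w * y * z) = w * (x * y * z) by intros; ring,
        mul_comm]
      simp only [← Complex.exp_add]
      congr 2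
      push_cast
      ring
    have hm1 : Measurable[𝓕 s] fun ω => f ω * Complex.exp (a * (B s ω - B u ω : ℝ)) := by
      have h := hB.measurable_mul_cexp hus (hst.trans ht) (f := fun _ => 1) measurable_const a
      simp only [one_mul] at h
      exact hf.mul h
    simp_rw [e1, e2, integral_const_mul]
    rw [hB.integral_mul_cexp ht le_rfl (hB.measurable_mul_cexp hst ht hm1 _),
      hB.integral_mul_cexp hst ht hm1, hB.integral_mul_cexp (hst.trans ht) le_rfl hm1]
    rw [show ∀ x z w v : ℂ, x * ((w * z) * v) = w * (x * z * v) by intros; ring,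
      show ∀ x y z w : ℂ, x * (w * y) * z = w * (x * y * z) by intros; ring]
    simp only [← Complex.exp_add]
    congr 2
    push_cast
    ring_nf
    rw [hI]
    ring

/-- Girsanov's theorem for the constant drift `a` switched on at time `u`. -/
lemma exists_add_drift (hB : IsBrownianOn 𝓕 Q T B) [IsProbabilityMeasure Q] (a : ℝ) {u : ℝ≥0}
    (hu : u ≤ T) :
    ∃ Q' : Measure Ω, IsProbabilityMeasure Q' ∧ Q' ≪ Q ∧ Q ≪ Q' ∧
      IsBrownianOn 𝓕 Q' T (fun t ω => B t ω - a * (t - u : ℝ≥0)) := by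
  have hmD := hB.measurable_density a hu
  let Q' := Q.withDensity fun ω => ENNReal.ofReal (density B T a u ω)
  have hint : ∀ g : Ω → ℂ, ∫ ω, g ω ∂Q' = ∫ ω, (density B T a u ω : ℂ) * g ω ∂Q := by
    intro g
    rw [integral_withDensity_eq_integral_toReal_smul hmD.ennreal_ofReal (by simp)]
    refine integral_congr_ae (Filter.Eventually.of_forall fun ω => ?_)
    simp [ENNReal.toReal_ofReal (Real.exp_pos _).le, density]
  have hone : ∫ ω, (density B T a u ω : ℂ) ∂Q = 1 := by
    have h := hB.integral_mul_cexp hu le_rfl (f := fun _ => 1) measurable_const a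
    simp_rw [coe_density]
    rw [integral_mul_const]
    simp only [one_mul, integral_const, probReal_univ, one_smul] at h
    rw [h, ← Complex.exp_add]
    simp
  have hprob : IsProbabilityMeasure Q' := by
    refine ⟨?_⟩
    have h1 : ∫ ω, density B T a u ω ∂Q = 1 := by
      exact_mod_cast integral_complex_ofReal.symm.trans hone
    -- A non-integrable function has Bochner integral `0`, so the value `1` already forces
    -- integrability.
    have h2 : Integrable (density B T a u) Q := by
      by_contra h
      rw [integral_undef h] at h1
      exact zero_ne_one h1
    rw [withDensity_apply _ MeasurableSet.univ, Measure.restrict_univ,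
      ← ofReal_integral_eq_lintegral_ofReal h2
        (Filter.Eventually.of_forall fun ω => (Real.exp_pos _).le), h1, ENNReal.ofReal_one]
  have hac : Q' ≪ Q := withDensity_absolutelyContinuous _ _
  have hac' : Q ≪ Q' := by
    refine withDensity_absolutelyContinuous' hmD.ennreal_ofReal.aemeasurable ?_
    exact Filter.Eventually.of_forall fun ω => by
      simp [density, Real.exp_pos]
  have hmeas : ∀ t ≤ T, Measurable[𝓕 t] fun ω => B t ω - a * (t - u : ℝ≥0) := fun t ht =>
    (hB.adapted t ht).sub_const _
  have key : ∀ s t, s ≤ t → t ≤ T →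
      Indep (MeasurableSpace.comap (fun ω => (B t ω - a * (t - u : ℝ≥0))
        - (B s ω - a * (s - u : ℝ≥0))) inferInstance) (𝓕 s) Q' ∧
      HasLaw (fun ω => (B t ω - a * (t - u : ℝ≥0)) - (B s ω - a * (s - u : ℝ≥0)))
        (gaussianReal 0 (t - s)) Q' := by
    intro s t hst ht
    refine indep_and_hasLaw_of_setIntegral_cexp
      (((hmeas t ht).mono (𝓕.le t) le_rfl).sub
        ((hmeas s (hst.trans ht)).mono (𝓕.le s) le_rfl)) ?_
    intro A hA θ
    have hmA : MeasurableSet A := 𝓕.le s _ hA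
    have hf : Measurable[𝓕 s] (A.indicator fun _ => (1 : ℂ)) := measurable_const.indicator hA
    have h := hB.integral_density_mul a hu hst ht hf θ
    rw [← hint, ← hint, integral_indicator_const _ hmA] at h
    rw [← integral_indicator hmA]
    convert h using 1
    · congr 1
      funext ω
      by_cases hω : ω ∈ A
      · simp only [hω, indicator_of_mem, one_mul]
        congr 1
        simp only [Pi.sub_apply]
        ring
      · simp [hω]
    · rw [NNReal.coe_sub hst]
      simp
  exact ⟨Q', hprob, hac, hac', hmeas, by
      filter_upwards [hac.ae_le hB.zero] with ω hω
      simp [hω], by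
      filter_upwards [hac.ae_le hB.cont] with ω hω
      refine hω.sub (Continuous.continuousOn ?_)
      fun_prop, fun s t hst ht => (key s t hst ht).1, fun s t hst ht => (key s t hst ht).2⟩

/-- Girsanov's theorem for a deterministic step drift. -/
lemma exists_add_step_drift (hB : IsBrownianOn 𝓕 Q T B) [IsProbabilityMeasure Q] (n : ℕ)
    (a : ℕ → ℝ) (u : ℕ → ℝ≥0) (hu : ∀ j < n, u j ≤ T) :
    ∃ Q' : Measure Ω, IsProbabilityMeasure Q' ∧ Q' ≪ Q ∧ Q ≪ Q' ∧
      IsBrownianOn 𝓕 Q' T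
        (fun t ω => B t ω - ∑ j ∈ Finset.range n, a j * (t - u j : ℝ≥0)) := by
  induction n with
  | zero => exact ⟨Q, inferInstance, .rfl, .rfl, by simpa using hB⟩
  | succ n ih =>
    obtain ⟨Q₁, hp, h1, h2, h3⟩ := ih fun j hj => hu j (hj.trans n.lt_succ_self)
    obtain ⟨Q₂, hp₂, h4, h5, h6⟩ := h3.exists_add_drift (a n) (hu n n.lt_succ_self)
    refine ⟨Q₂, hp₂, h4.trans h1, h2.trans h5, ?_⟩
    convert h6 using 3
    rw [Finset.sum_range_succ]
    ring

end IsBrownianOn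

/-! ### Deterministic step efforts and uniform approximation. -/

lemma isStronglyPredictable_of_measurable {Ω : Type*} [m : MeasurableSpace Ω]
    (𝓕 : Filtration ℝ≥0 m) {a : ℝ≥0 → ℝ} (ha : Measurable a) :
    IsStronglyPredictable 𝓕 fun t (_ : Ω) => a t := by
  have hfst : Measurable[𝓕.predictable] (Prod.fst : ℝ≥0 × Ω → ℝ≥0) := by
    let _ : MeasurableSpace (ℝ≥0 × Ω) := 𝓕.predictable
    refine measurable_of_Ioi fun t => ?_
    have h := measurableSet_predictable_Ioi_prod (𝓕 := 𝓕) (i := t)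
      (@MeasurableSet.univ Ω (𝓕 t))
    rwa [prod_univ] at h
  exact (ha.comp hfst).stronglyMeasurable

/-- The step function with jump `c j` immediately after time `u j`. -/
noncomputable def stepFun (n : ℕ) (c : ℕ → ℝ) (u : ℕ → ℝ≥0) (t : ℝ≥0) : ℝ :=
  ∑ j ∈ Finset.range n, c j * if u j < t then 1 else 0

lemma measurable_stepFun (n : ℕ) (c : ℕ → ℝ) (u : ℕ → ℝ≥0) : Measurable (stepFun n c u) := by
  unfold stepFun
  refine Finset.measurable_sum _ fun j _ => Measurable.const_mul ?_ _
  exact Measurable.ite measurableSet_Ioi measurable_const measurable_const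

/-- The truncated difference `t - u` in `ℝ≥0` is exactly the drift shape of `exists_add_drift`. -/
lemma intervalIntegrable_and_integral_ite_lt (u t : ℝ≥0) :
    IntervalIntegrable (fun s : ℝ => if u < s.toNNReal then (1 : ℝ) else 0) volume 0 t ∧
    ∫ s in (0 : ℝ)..t, (if u < s.toNNReal then (1 : ℝ) else 0) = (t - u : ℝ≥0) := by
  have key : ∀ a b : ℝ, IntervalIntegrable
      (fun s : ℝ => if u < s.toNNReal then (1 : ℝ) else 0) volume a b := by
    intro a b
    refine (intervalIntegrable_const (c := (1 : ℝ))).mono_fun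
      (Measurable.aestronglyMeasurable ?_) ?_
    · exact Measurable.ite (measurableSet_lt measurable_const measurable_real_toNNReal)
        measurable_const measurable_const
    · refine Filter.Eventually.of_forall fun s => ?_
      dsimp only
      split_ifs <;> simp
  refine ⟨key _ _, ?_⟩
  have h0 : ∀ v : ℝ≥0, v ≤ u →
      ∫ s in (0 : ℝ)..v, (if u < s.toNNReal then (1 : ℝ) else 0) = 0 := by
    intro v hv
    rw [intervalIntegral.integral_of_le v.coe_nonneg]
    refine (setIntegral_congr_fun measurableSet_Ioc fun s hs => ?_).trans (integral_zero _ _)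
    have : ¬ u < s.toNNReal := not_lt.2 ((Real.toNNReal_le_iff_le_coe.2 hs.2).trans hv)
    simp [this]
  rcases le_total t u with h | h
  · rw [h0 t h, tsub_eq_zero_of_le h, NNReal.coe_zero]
  · rw [← intervalIntegral.integral_add_adjacent_intervals (key 0 u) (key u t), h0 u le_rfl,
      zero_add, NNReal.coe_sub h, intervalIntegral.integral_of_le (show (u : ℝ) ≤ t from h)]
    rw [setIntegral_congr_fun (g := fun _ => (1 : ℝ)) measurableSet_Ioc fun s hs => ?_]
    · have : (u : ℝ) ≤ t := h
      simp [this]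
    · have : u < s.toNNReal := Real.lt_toNNReal_iff_coe_lt.2 hs.1
      simp [this]

/-- The jumps telescope to the value of `g` at the last node strictly before `t`. The case `j = 0`
is separate because truncated subtraction gives `0 - 1 = 0`, which would erase the first jump. -/
lemma stepFun_eq_of_monotone {g : ℕ → ℝ} {s : ℕ → ℝ≥0} (hs : Monotone s) (hs0 : s 0 = 0)
    {t : ℝ≥0} (ht : 0 < t) (n : ℕ) :
    ∃ K ≤ n, s K < t ∧ (K < n → t ≤ s (K + 1)) ∧
      stepFun (n + 1) (fun j => g j - if j = 0 then 0 else g (j - 1)) s t = g K := by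
  induction n with
  | zero => exact ⟨0, le_rfl, hs0 ▸ ht, by simp, by simp [stepFun, hs0, ht]⟩
  | succ n ih =>
    obtain ⟨K, hKn, hK1, hK2, hK3⟩ := ih
    have hrec : stepFun (n + 1 + 1) (fun j => g j - if j = 0 then 0 else g (j - 1)) s t
        = g K + (g (n + 1) - g n) * if s (n + 1) < t then 1 else 0 := by
      rw [← hK3, stepFun, Finset.sum_range_succ]
      simp [stepFun]
    by_cases h : s (n + 1) < t
    · have hK : K = n := by
        by_contra hne
        have hlt : K < n := lt_of_le_of_ne hKn hne
        exact absurd (h.trans_le (hK2 hlt)) (not_lt.2 (hs (by omega)))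
      subst hK
      exact ⟨K + 1, le_rfl, h, by simp, by rw [hrec, if_pos h]; ring⟩
    · refine ⟨K, hKn.trans n.le_succ, hK1, fun hK => ?_, by rw [hrec, if_neg h]; ring⟩
      rcases hKn.lt_or_eq with hlt | rfl
      · exact hK2 hlt
      · exact not_lt.1 h

namespace PAModel

variable {Ω : Type*} [m : MeasurableSpace Ω] (M : PAModel Ω)

lemma exists_isEffortMeasure_stepFun (n : ℕ) (c : ℕ → ℝ) (u : ℕ → ℝ≥0)
    (hu : ∀ j < n, u j ≤ M.T) :
    ∃ Q : Measure Ω, M.IsEffortMeasure (fun t _ => stepFun n c u t) Q := by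
  have := M.isProb
  obtain ⟨Q, hQ, h1, h2, h3⟩ := M.isBrownianOn_W.exists_add_step_drift n
    (fun j => c j / M.σ) u hu
  refine ⟨Q, hQ, h1, h2, ?_⟩
  convert h3 using 3 with t ω
  simp only [Wα, stepFun, Finset.sum_div]
  congr 1
  rw [intervalIntegral.integral_finsetSum]
  · refine Finset.sum_congr rfl fun j _ => ?_
    rw [← (intervalIntegrable_and_integral_ite_lt (u j) t).2,
      ← intervalIntegral.integral_const_mul]
    refine intervalIntegral.integral_congr fun s _ => ?_
    ring
  · intro j _
    exact ((intervalIntegrable_and_integral_ite_lt (u j) t).1.const_mul (c j)).div_const M.σ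

lemma h_continuousOn : ContinuousOn M.h (Ici 0) := M.h_contDiff.continuousOn

/-- Continuous deterministic efforts are uniform limits of efforts with an effort measure. -/
lemma exists_effort_approx {f : ℝ → ℝ} (hf : Continuous f) (hf0 : ∀ t, f t ∈ Icc 0 M.abar)
    {η : ℝ} (hη : 0 < η) :
    ∃ (a : ℝ≥0 → ℝ) (Q : Measure Ω), M.Effort (fun t _ => a t) ∧
      M.IsEffortMeasure (fun t _ => a t) Q ∧ ∀ t ∈ Ioc (0 : ℝ) M.T,
        |a t.toNNReal - f t| ≤ η ∧ |M.h (a t.toNNReal) - M.h (f t)| ≤ η := by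
  have hhf : Continuous fun t => M.h (f t) :=
    M.h_continuousOn.comp_continuous hf fun t => (hf0 t).1
  -- Uniform continuity of the pair `(f, h ∘ f)` lets one mesh serve both the effort and its cost.
  have huc := isCompact_Icc.uniformContinuousOn_of_continuous (s := Icc (0 : ℝ) M.T)
    (hf.prodMk hhf).continuousOn
  obtain ⟨d, hd, hd'⟩ := Metric.uniformContinuousOn_iff.1 huc η hη
  obtain ⟨n, hn⟩ := exists_nat_gt ((M.T : ℝ) / d)
  have hT : (0 : ℝ) < M.T := M.T_pos
  have hn0 : (0 : ℝ) < (n : ℝ) + 1 := by positivity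
  let s : ℕ → ℝ≥0 := fun j => j * (M.T / (n + 1))
  have hs : Monotone s := fun i j hij => by
    simp only [s]
    gcongr
  have hs0 : s 0 = 0 := by simp [s]
  let g : ℕ → ℝ := fun j => f (s j)
  let a : ℝ≥0 → ℝ := stepFun (n + 1) (fun j => g j - if j = 0 then 0 else g (j - 1)) s
  have hsT : s (n + 1) = M.T := by
    simp only [s]
    push_cast
    field_simp
  have hsle : ∀ j < n + 1, s j ≤ M.T := fun j hj => hsT ▸ hs hj.le
  obtain ⟨Q, hQ⟩ := M.exists_isEffortMeasure_stepFun (n + 1)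
    (fun j => g j - if j = 0 then 0 else g (j - 1)) s hsle
  have hma : Measurable a := measurable_stepFun _ _ _
  refine ⟨a, Q, ⟨isStronglyPredictable_of_measurable _ hma, fun t ω => ?_⟩, hQ,
    fun t ht => ?_⟩
  -- At `t = 0` no jump has occurred, so the effort is `0`; it is admissible there, and closeness to
  -- `f` is claimed on `(0, T]` only.
  · rcases (zero_le : 0 ≤ t).eq_or_lt with rfl | ht
    · have : a 0 = 0 := by simp [a, stepFun]
      simp only [this]
      exact ⟨le_rfl, M.abar_pos.le⟩
    · obtain ⟨K, -, -, -, hK⟩ := stepFun_eq_of_monotone (g := g) hs hs0 ht n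
      simp only [a, hK]
      exact hf0 _
  · obtain ⟨K, hKn, hK1, hK2, hK⟩ := stepFun_eq_of_monotone (g := g) hs hs0
      (Real.toNNReal_pos.2 ht.1) n
    have ha : a t.toNNReal = f (s K) := hK
    rw [ha]
    have hlt : (s K : ℝ) < t := Real.lt_toNNReal_iff_coe_lt.1 hK1
    have hle : t ≤ s (K + 1) := by
      rcases hKn.lt_or_eq with h | rfl
      · exact (Real.toNNReal_le_iff_le_coe).1 (hK2 h)
      · rw [hsT]; exact ht.2
    have hstep : (s (K + 1) : ℝ) = s K + M.T / (n + 1) := by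
      simp only [s]
      push_cast
      ring
    have hsmall : (M.T : ℝ) / (n + 1) < d := by
      rw [div_lt_iff₀ hd] at hn
      rw [div_lt_iff₀ hn0]
      nlinarith
    have hdist : dist (s K : ℝ) t < d := by
      rw [Real.dist_eq, abs_lt]
      constructor <;> linarith
    have h := hd' (s K) ⟨(s K).2, hlt.le.trans ht.2⟩ t ⟨ht.1.le, ht.2⟩ hdist
    rw [Prod.dist_eq, max_lt_iff, Real.dist_eq, Real.dist_eq] at h
    exact ⟨h.1.le, h.2.le⟩

end PAModel

/-! ### The conjugates `Fstar` and `Gstar` and their optimizers. -/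

/-- Tangent line inequality: Bernoulli's inequality applied to `z / y - 1`. -/
lemma rpow_add_mul_sub_le_rpow {p : ℝ} (hp : 1 < p) {y z : ℝ} (hy : 0 ≤ y) (hz : 0 ≤ z) :
    y ^ p + p * y ^ (p - 1) * (z - y) ≤ z ^ p := by
  rcases hy.eq_or_lt with rfl | hy
  · rw [Real.zero_rpow (by linarith), Real.zero_rpow (by linarith)]
    simpa using Real.rpow_nonneg hz p
  · have h := one_add_mul_self_le_rpow_one_add (s := z / y - 1)
      (by linarith [div_nonneg hz hy.le]) hp.le
    rw [add_sub_cancel, Real.div_rpow hz hy.le] at h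
    have hyp : 0 < y ^ p := Real.rpow_pos_of_pos hy p
    rw [le_div_iff₀ hyp] at h
    rw [Real.rpow_sub_one hy.ne']
    calc y ^ p + p * (y ^ p / y) * (z - y) = (1 + p * (z / y - 1)) * y ^ p := by
          field_simp
      _ ≤ z ^ p := h

namespace PAModel

variable {Ω : Type*} [m : MeasurableSpace Ω] (M : PAModel Ω)

lemma γ_pos : 0 < M.γ := zero_lt_one.trans M.one_lt_γ

/-- The minimizer in the definition of `Fstar κ p`. -/
noncomputable def yopt (κ p : ℝ) : ℝ := (max (-p) 0 / ((1 + κ) * M.γ)) ^ (1 / (M.γ - 1))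

lemma yopt_nonneg {κ : ℝ} (hκ : 0 ≤ κ) (p : ℝ) : 0 ≤ M.yopt κ p := by
  have := M.γ_pos
  unfold yopt
  positivity

lemma continuous_yopt (κ : ℝ) : Continuous (M.yopt κ) := by
  have h : 0 ≤ 1 / (M.γ - 1) := one_div_nonneg.2 (by linarith [M.one_lt_γ])
  unfold yopt
  exact (by fun_prop : Continuous fun p : ℝ => max (-p) 0 / ((1 + κ) * M.γ)).rpow_const
    fun _ => Or.inr h

/-- First-order condition for the minimization in `Fstar`; the tangent inequality then makes `yopt`
a global minimizer. -/
lemma yopt_rpow {κ : ℝ} (hκ : 0 ≤ κ) {p : ℝ} (hp : p ≤ 0) :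
    (1 + κ) * (M.γ * M.yopt κ p ^ (M.γ - 1)) = -p := by
  have h1 := M.one_lt_γ
  have h2 := M.γ_pos
  have h3 : 0 ≤ -p / ((1 + κ) * M.γ) := div_nonneg (by linarith) (by positivity)
  rw [yopt, max_eq_left (by linarith), ← Real.rpow_mul h3,
    one_div_mul_cancel (by linarith), Real.rpow_one]
  field_simp

lemma isLeast_Fstar {κ : ℝ} (hκ : 0 ≤ κ) {p : ℝ} (hp : p ≤ 0) :
    IsLeast ((fun y => y * p - (1 + κ) * M.F y) '' Ici 0)
      (M.yopt κ p * p + (1 + κ) * M.yopt κ p ^ M.γ) := by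
  refine ⟨⟨M.yopt κ p, M.yopt_nonneg hκ p, by simp [F]⟩, ?_⟩
  rintro _ ⟨z, hz, rfl⟩
  have h := mul_le_mul_of_nonneg_left
    (rpow_add_mul_sub_le_rpow M.one_lt_γ (M.yopt_nonneg hκ p) hz)
    (by linarith : (0 : ℝ) ≤ 1 + κ)
  have h2 := M.yopt_rpow hκ hp
  have h3 : (1 + κ) * (M.yopt κ p ^ M.γ + M.γ * M.yopt κ p ^ (M.γ - 1) * (z - M.yopt κ p))
      = (1 + κ) * M.yopt κ p ^ M.γ + -p * (z - M.yopt κ p) := by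
    rw [← h2]; ring
  simp only [F]
  linarith

lemma Fstar_eq_yopt {κ : ℝ} (hκ : 0 ≤ κ) {p : ℝ} (hp : p ≤ 0) :
    M.Fstar κ p = M.yopt κ p * p + (1 + κ) * M.yopt κ p ^ M.γ :=
  (M.isLeast_Fstar hκ hp).csInf_eq

lemma Fstar_le {κ : ℝ} (hκ : 0 ≤ κ) {p : ℝ} (hp : p ≤ 0) {y : ℝ} (hy : 0 ≤ y) :
    M.Fstar κ p ≤ y * p + (1 + κ) * y ^ M.γ := by
  rw [M.Fstar_eq_yopt hκ hp]
  have h := (M.isLeast_Fstar hκ hp).2 ⟨y, hy, rfl⟩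
  simp only [F] at h
  linarith

/-- The exponent conjugate to `γ`. -/
noncomputable def γconj : ℝ := M.γ / (M.γ - 1)

lemma one_lt_γconj : 1 < M.γconj := by
  have := M.one_lt_γ
  rw [γconj, one_lt_div (by linarith)]
  linarith

/-- The minimizer scales like `(-p)^(1/(γ-1))`, and the first-order condition reduces the minimum to
`-(1 - 1/γ) (-p)` times the minimizer. -/
lemma exists_Fstar_eq {κ : ℝ} (hκ : 0 ≤ κ) :
    ∃ c : ℝ, 0 < c ∧ ∀ p ≤ 0, M.Fstar κ p = -(c * (-p) ^ M.γconj) := by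
  have h1 := M.one_lt_γ
  have h2 := M.γ_pos
  have hb : 0 < (1 + κ) * M.γ := by positivity
  have hg : 0 < M.γ - 1 := by linarith
  refine ⟨(((1 + κ) * M.γ) ^ (1 / (M.γ - 1)))⁻¹ * (1 - 1 / M.γ), ?_, fun p hp => ?_⟩
  · have : 1 / M.γ < 1 := (div_lt_one h2).2 h1
    have : 0 < 1 - 1 / M.γ := by linarith
    positivity
  · rw [M.Fstar_eq_yopt hκ hp]
    have h3 := M.yopt_rpow hκ hp
    have hy := M.yopt_nonneg hκ p
    have h4 : M.yopt κ p ^ M.γ = M.yopt κ p ^ (M.γ - 1) * M.yopt κ p := by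
      rw [← Real.rpow_add_one' hy (by linarith), sub_add_cancel]
    have h5 : M.yopt κ p * -p
        = (((1 + κ) * M.γ) ^ (1 / (M.γ - 1)))⁻¹ * (-p) ^ M.γconj := by
      rw [yopt, max_eq_left (by linarith), Real.div_rpow (by linarith) hb.le,
        show M.γconj = 1 / (M.γ - 1) + 1 by rw [γconj]; field_simp; ring,
        Real.rpow_add_one' (by linarith) (by positivity)]
      ring
    have h6 : (1 + κ) * M.yopt κ p ^ M.γ = -p * M.yopt κ p / M.γ := by
      rw [h4, ← h3]
      field_simp
    rw [h6, show ∀ x y : ℝ, x * (1 - 1 / M.γ) * y = x * y * (1 - 1 / M.γ) by intros; ring, ← h5]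
    field_simp
    ring

/-- The growth rate of the bonus contribution in the time of payment. -/
noncomputable def bonusRate : ℝ := M.ρ * (1 - M.δ * M.γ) / (M.γ - 1)

/-- The payment time enters only through an exponential, and the sign of its rate decides between
the three cases of the theorem. -/
lemma exists_bonus_eq : ∃ c : ℝ, 0 < c ∧ ∀ l ≤ 0, ∀ s : ℝ,
    M.bonus s l = c * (-l) ^ M.γconj * Real.exp (M.bonusRate * s) := by
  obtain ⟨c, hc, h⟩ := M.exists_Fstar_eq M.k_pos.le
  refine ⟨c, hc, fun l hl s => ?_⟩
  have hg : M.γ - 1 ≠ 0 := by linarith [M.one_lt_γ]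
  have hρ := M.ρ_pos.ne'
  rw [bonus, h _ (mul_nonpos_of_nonpos_of_nonneg hl (Real.exp_pos _).le),
    ← neg_mul l, Real.mul_rpow (by linarith) (Real.exp_pos _).le, ← Real.exp_mul]
  have : Real.exp (M.bonusRate * s)
      = Real.exp (-M.ρ * s) * Real.exp ((M.ρ - M.r) * s * M.γconj) := by
    rw [← Real.exp_add]
    congr 1
    rw [bonusRate, γconj, δ]
    field_simp
    ring
  rw [this]
  ring

lemma bonus_zero (l : ℝ) : M.bonus 0 l = -M.Fstar M.k l := by
  simp [bonus]

lemma h_nonneg {a : ℝ} (ha : 0 ≤ a) : 0 ≤ M.h a :=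
  M.h_zero ▸ M.h_mono (mem_Ici.2 le_rfl) ha ha

lemma continuousOn_effort_gain (p : ℝ) :
    ContinuousOn (fun a => a + M.h a * p) (Icc 0 M.abar) :=
  continuousOn_id.add ((M.h_continuousOn.mono Icc_subset_Ici_self).mul continuousOn_const)

lemma le_Gstar (p : ℝ) {a : ℝ} (ha : a ∈ Icc 0 M.abar) : a + M.h a * p ≤ M.Gstar p :=
  le_csSup (isCompact_Icc.image_of_continuousOn (M.continuousOn_effort_gain p)).bddAbove
    ⟨a, ha, rfl⟩

lemma exists_isMaxOn_effort (p : ℝ) :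
    ∃ a : Icc 0 M.abar, IsMaxOn (fun a => a + M.h a * p) (Icc 0 M.abar) a := by
  obtain ⟨a, ha, h⟩ := isCompact_Icc.exists_isMaxOn (nonempty_Icc.2 M.abar_pos.le)
    (M.continuousOn_effort_gain p)
  exact ⟨⟨a, ha⟩, h⟩

/-- For `p < 0` the objective is strictly concave and the midpoint of two maximizers would beat
both; for `p = 0` it is the identity. -/
lemma isMaxOn_effort_unique {p : ℝ} (hp : p ≤ 0) {a b : ℝ} (ha : a ∈ Icc 0 M.abar)
    (hb : b ∈ Icc 0 M.abar) (hma : IsMaxOn (fun a => a + M.h a * p) (Icc 0 M.abar) a)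
    (hmb : IsMaxOn (fun a => a + M.h a * p) (Icc 0 M.abar) b) : a = b := by
  by_contra hne
  have h1 := isMaxOn_iff.1 hma b hb
  have h2 := isMaxOn_iff.1 hmb a ha
  rcases hp.eq_or_lt with rfl | hp
  · simp only [mul_zero, add_zero] at h1 h2
    exact hne (le_antisymm h2 h1)
  · have hc : (1 / 2 : ℝ) * a + (1 / 2) * b ∈ Icc 0 M.abar := by
      constructor <;> linarith [ha.1, ha.2, hb.1, hb.2]
    have h3 := isMaxOn_iff.1 hma _ hc
    have h4 := M.h_strictConvex.2 (mem_Ici.2 ha.1) (mem_Ici.2 hb.1) hne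
      (by norm_num : (0 : ℝ) < 1 / 2) (by norm_num : (0 : ℝ) < 1 / 2) (by norm_num)
    simp only [smul_eq_mul] at h4
    have h5 := mul_lt_mul_of_neg_right h4 hp
    linarith

/-- The optimal effort at the multiplier `p` (at `0` for positive `p`). -/
noncomputable def aopt (p : ℝ) : Icc 0 M.abar :=
  (M.exists_isMaxOn_effort (min p 0)).choose

lemma isMaxOn_aopt (p : ℝ) :
    IsMaxOn (fun a => a + M.h a * min p 0) (Icc 0 M.abar) (M.aopt p) :=
  (M.exists_isMaxOn_effort (min p 0)).choose_spec

/-- A unique maximizer over a compact set has a closed graph, and projecting along the compact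
factor `[0, abar]` preserves closedness. Uniqueness identifies the graph with the set of maximizing
pairs. -/
lemma continuous_aopt : Continuous M.aopt := by
  have hh : Continuous fun a : Icc 0 M.abar => M.h a :=
    (M.h_continuousOn.mono Icc_subset_Ici_self).domRestrict
  have hgraph : IsClosed {x : ℝ × Icc 0 M.abar |
      ∀ b ∈ Icc 0 M.abar, b + M.h b * min x.1 0 ≤ x.2 + M.h x.2 * min x.1 0} := by
    simp only [ofPred_forall]
    refine isClosed_biInter fun b _ => isClosed_le (by fun_prop) ?_
    have := hh.comp (continuous_snd (X := ℝ))
    exact (continuous_subtype_val.comp continuous_snd).add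
      (this.mul (continuous_fst.min continuous_const))
  refine continuous_iff_isClosed.2 fun C hC => ?_
  have : M.aopt ⁻¹' C = Prod.fst '' ({x : ℝ × Icc 0 M.abar |
      ∀ b ∈ Icc 0 M.abar, b + M.h b * min x.1 0 ≤ x.2 + M.h x.2 * min x.1 0}
        ∩ Prod.snd ⁻¹' C) := by
    ext p
    constructor
    · intro hp
      exact ⟨(p, M.aopt p), ⟨fun b hb => isMaxOn_iff.1 (M.isMaxOn_aopt p) b hb, hp⟩, rfl⟩
    · rintro ⟨⟨q, a⟩, ⟨h1, h2⟩, rfl⟩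
      have : M.aopt q = a := Subtype.ext <| M.isMaxOn_effort_unique (min_le_right q 0)
        (M.aopt q).2 a.2 (M.isMaxOn_aopt q) (isMaxOn_iff.2 h1)
      simpa [this] using h2
  rw [this]
  exact isClosedMap_fst_of_compactSpace _ (hgraph.inter (hC.preimage continuous_snd))

lemma continuous_h_aopt : Continuous fun p => M.h (M.aopt p) :=
  M.h_continuousOn.comp_continuous (continuous_subtype_val.comp M.continuous_aopt)
    fun p => (M.aopt p).2.1

lemma Gstar_eq {p : ℝ} (hp : p ≤ 0) : M.Gstar p = M.aopt p + M.h (M.aopt p) * p := by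
  refine IsGreatest.csSup_eq ⟨⟨M.aopt p, (M.aopt p).2, rfl⟩, ?_⟩
  rintro _ ⟨b, hb, rfl⟩
  have h := isMaxOn_iff.1 (M.isMaxOn_aopt p) b hb
  rwa [min_eq_left hp] at h

lemma δ_pos : 0 < M.δ := div_pos M.r_pos M.ρ_pos

lemma δ_mul_exp_nonpos {l : ℝ} (hl : l ≤ 0) (x : ℝ) : M.δ * l * Real.exp x ≤ 0 :=
  mul_nonpos_of_nonpos_of_nonneg (mul_nonpos_of_nonneg_of_nonpos M.δ_pos.le hl)
    (Real.exp_pos _).le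

lemma continuous_Gstar_integrand {l : ℝ} (hl : l ≤ 0) :
    Continuous fun t : ℝ => M.ρ * Real.exp (-M.ρ * t) *
      M.Gstar (M.δ * l * Real.exp ((M.ρ - M.r) * t)) := by
  have h1 := M.continuous_h_aopt
  have h2 := M.continuous_aopt
  simp_rw [fun t : ℝ => M.Gstar_eq (M.δ_mul_exp_nonpos hl ((M.ρ - M.r) * t))]
  have h3 : Continuous fun t : ℝ => M.δ * l * Real.exp ((M.ρ - M.r) * t) := by fun_prop
  have h4 := h1.comp h3
  have h5 := continuous_subtype_val.comp (h2.comp h3)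
  exact (by fun_prop : Continuous fun t : ℝ => M.ρ * Real.exp (-M.ρ * t)).mul
    (h5.add (h4.mul h3))

end PAModel

/-! ### Measurability and integrability of the payoffs. -/

lemma predictable_le_prod {Ω : Type*} [m : MeasurableSpace Ω] (𝓕 : Filtration ℝ≥0 m) :
    𝓕.predictable ≤ (inferInstance : MeasurableSpace (ℝ≥0 × Ω)) :=
  measurableSpace_le_predictable_of_measurableSet
    (fun _ hA => (measurableSet_singleton _).prod (𝓕.le _ _ hA))
    (fun _ _ hA => measurableSet_Ioi.prod (𝓕.le _ _ hA))

namespace PAModel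

variable {Ω : Type*} [m : MeasurableSpace Ω] (M : PAModel Ω)

lemma u_nonneg {x : ℝ} (hx : 0 ≤ x) : 0 ≤ M.u x := Real.rpow_nonneg hx _

lemma u_rpow {x : ℝ} (hx : 0 ≤ x) : M.u x ^ M.γ = x := by
  rw [u, ← Real.rpow_mul hx, one_div_mul_cancel M.γ_pos.ne', Real.rpow_one]

section Integrability

variable {M} {α : ℝ≥0 → Ω → ℝ} {Q : Measure Ω}

lemma Effort.measurable_uncurry (hα : M.Effort α) : Measurable (Function.uncurry α) :=
  hα.1.measurable.mono (predictable_le_prod _) le_rfl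

lemma Effort.integrable_running (hα : M.Effort α) [IsProbabilityMeasure Q] {w H : ℝ → ℝ}
    (hw : Continuous w) (hH : Measurable H) {K : ℝ} (hK : ∀ x ∈ Icc 0 M.abar, |H x| ≤ K) :
    Integrable (fun ω => ∫ t in (0 : ℝ)..M.T, w t * H (α t.toNNReal ω)) Q ∧
      ∀ ω, IntervalIntegrable (fun t => w t * H (α t.toNNReal ω)) volume 0 M.T := by
  have hm : Measurable (Function.uncurry fun (ω : Ω) (t : ℝ) => w t * H (α t.toNNReal ω)) := by
    have h1 : Measurable fun x : Ω × ℝ => α x.2.toNNReal x.1 :=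
      hα.measurable_uncurry.comp
        ((measurable_real_toNNReal.comp measurable_snd).prodMk measurable_fst)
    exact (hw.measurable.comp measurable_snd).mul (hH.comp h1)
  obtain ⟨c, hc⟩ := isCompact_Icc.exists_bound_of_continuousOn (s := Icc (0 : ℝ) M.T)
    hw.continuousOn
  have hbound : ∀ ω, ∀ t ∈ uIoc (0 : ℝ) M.T, ‖w t * H (α t.toNNReal ω)‖ ≤ c * K := by
    intro ω t ht
    rw [uIoc_of_le M.T.coe_nonneg] at ht
    rw [norm_mul]
    have h1 := hc t ⟨ht.1.le, ht.2⟩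
    exact mul_le_mul h1 (hK _ (hα.2 _ _)) (norm_nonneg _) ((norm_nonneg _).trans h1)
  refine ⟨?_, fun ω => ?_⟩
  · refine Integrable.of_bound (C := c * K * |(M.T : ℝ) - 0|) ?_
      (Filter.Eventually.of_forall fun ω => ?_)
    · simp_rw [intervalIntegral.integral_of_le M.T.coe_nonneg]
      exact (hm.stronglyMeasurable.integral_prod_right
        (ν := volume.restrict (Ioc (0 : ℝ) M.T))).aestronglyMeasurable
    · exact intervalIntegral.norm_integral_le_of_norm_le_const (hbound ω)
  · refine (intervalIntegrable_const (c := c * K)).mono_fun ?_ ?_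
    · exact (hm.comp measurable_prodMk_left).aestronglyMeasurable
    · refine (ae_restrict_iff' measurableSet_uIoc).2 (Filter.Eventually.of_forall fun t ht => ?_)
      exact (hbound ω t ht).trans (le_abs_self _)

lemma Effort.integrable_cost (hα : M.Effort α) [IsProbabilityMeasure Q] :
    Integrable (fun ω => ∫ t in (0 : ℝ)..M.T,
        M.r * Real.exp (-M.r * t) * M.h (α t.toNNReal ω)) Q ∧
      ∀ ω, IntervalIntegrable (fun t => M.r * Real.exp (-M.r * t) * M.h (α t.toNNReal ω))
        volume 0 M.T := by
  -- `h` is controlled on `[0, ∞)` only. This monotone, hence measurable, modification agrees with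
  -- it at every effort value.
  have hmono : Monotone fun x => M.h (max x 0) := fun x y hxy =>
    M.h_mono (mem_Ici.2 (le_max_right _ _)) (mem_Ici.2 (le_max_right _ _))
      (max_le_max_right 0 hxy)
  have h := hα.integrable_running (Q := Q) (w := fun t => M.r * Real.exp (-M.r * t))
    (by fun_prop) hmono.measurable (K := M.h M.abar) fun x hx => by
      rw [max_eq_left hx.1, abs_of_nonneg (M.h_nonneg hx.1)]
      exact M.h_mono (mem_Ici.2 hx.1) (mem_Ici.2 M.abar_pos.le) hx.2
  simp only [fun (t : ℝ) ω => max_eq_left (hα.2 t.toNNReal ω).1] at h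
  exact h

lemma Effort.integrable_output (hα : M.Effort α) [IsProbabilityMeasure Q] :
    Integrable (fun ω => ∫ t in (0 : ℝ)..M.T,
        M.ρ * Real.exp (-M.ρ * t) * α t.toNNReal ω) Q ∧
      ∀ ω, IntervalIntegrable (fun t => M.ρ * Real.exp (-M.ρ * t) * α t.toNNReal ω)
        volume 0 M.T :=
  hα.integrable_running (w := fun t => M.ρ * Real.exp (-M.ρ * t)) (H := fun x => x)
    (by fun_prop) measurable_id (K := M.abar) fun x hx => by
      rw [abs_of_nonneg hx.1]
      exact hx.2

lemma integrable_of_lintegral_rpow (M : PAModel Ω) [IsProbabilityMeasure Q] {ξ : Ω → ℝ}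
    (hξ : Measurable ξ)
    (h0 : ∀ ω, 0 ≤ ξ ω) (hfin : ∫⁻ ω, ENNReal.ofReal (|ξ ω| ^ M.γ) ∂Q < ∞) :
    Integrable ξ Q ∧ Integrable (fun ω => M.u (ξ ω)) Q := by
  have h1 : Integrable (fun ω => |ξ ω| ^ M.γ) Q := by
    refine ⟨Measurable.aestronglyMeasurable (by fun_prop), ?_⟩
    rw [hasFiniteIntegral_iff_ofReal (Filter.Eventually.of_forall fun ω => by positivity)]
    exact hfin
  -- Used twice: `ξ` is dominated through `ξ^γ`, then `u ξ` through `(u ξ)^γ = ξ`.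
  have key : ∀ x p : ℝ, 0 ≤ x → 1 ≤ p → x ≤ 1 + x ^ p := by
    intro x p hx hp
    rcases le_total x 1 with h | h
    · linarith [Real.rpow_nonneg hx p]
    · have := Real.rpow_le_rpow_of_exponent_le h hp
      rw [Real.rpow_one] at this
      linarith
  have hint : Integrable ξ Q := by
    refine ((integrable_const 1).add h1).mono' hξ.aestronglyMeasurable
      (Filter.Eventually.of_forall fun ω => ?_)
    rw [Real.norm_of_nonneg (h0 ω)]
    simpa [abs_of_nonneg (h0 ω)] using key (ξ ω) M.γ (h0 ω) M.one_lt_γ.le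
  refine ⟨hint, ?_⟩
  refine ((integrable_const 1).add hint).mono'
    (Measurable.aestronglyMeasurable (by unfold u; fun_prop))
    (Filter.Eventually.of_forall fun ω => ?_)
  have hu : 0 ≤ M.u (ξ ω) := Real.rpow_nonneg (h0 ω) _
  rw [Real.norm_of_nonneg hu]
  have h2 := key (M.u (ξ ω)) M.γ hu M.one_lt_γ.le
  rwa [u_rpow _ (h0 ω)] at h2

lemma Admissible.integrable_ξ {C : Contract M.N Ω} (hC : M.Admissible C) (hα : M.Effort α)
    (hQ : M.IsEffortMeasure α Q) (i : Fin M.N) :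
    (Integrable (C.ξ i) Q ∧ Integrable (fun ω => M.u (C.ξ i ω)) Q) ∧
      (Integrable C.ξT Q ∧ Integrable (fun ω => M.u (C.ξT ω)) Q) := by
  have := hQ.isProb
  have h1 : (∫⁻ ω, ENNReal.ofReal (|C.ξ i ω| ^ M.γ) ∂Q) +
        ∫⁻ ω, ENNReal.ofReal (|C.ξT ω| ^ M.γ) ∂Q < ∞ := by
    refine lt_of_le_of_lt ?_ hC.integrability
    refine le_iSup_of_le i (le_iSup_of_le α (le_iSup_of_le Q ?_))
    exact le_iSup_of_le hα (le_iSup_of_le hQ le_rfl)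
  obtain ⟨h2, h3⟩ := ENNReal.add_lt_top.1 h1
  exact ⟨M.integrable_of_lintegral_rpow
      ((hC.ξ_meas i).mono (hC.stopping i).measurableSpace_le le_rfl) (hC.ξ_nonneg i) h2,
    M.integrable_of_lintegral_rpow (hC.ξT_meas.mono (M.𝓕.le _) le_rfl) hC.ξT_nonneg h3⟩

lemma Admissible.measurable_τ {C : Contract M.N Ω} (hC : M.Admissible C) (i : Fin M.N) :
    Measurable (C.τ i) := by
  refine measurable_of_Iic fun t => ?_
  have h := M.𝓕.le t _ (hC.stopping i t)
  have he : {ω | (C.τ i ω : WithTop ℝ≥0) ≤ t} = C.τ i ⁻¹' Iic t := by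
    ext ω
    exact WithTop.coe_le_coe
  exact he ▸ h

lemma Admissible.integrable_discounted {C : Contract M.N Ω} (hC : M.Admissible C) {q : ℝ}
    (hq : 0 ≤ q) (i : Fin M.N) {f : Ω → ℝ} (hf : Integrable f Q) :
    Integrable (fun ω => Real.exp (-q * C.τ i ω) * f ω) Q := by
  have hτ := hC.measurable_τ i
  refine hf.bdd_mul (c := 1) (Measurable.aestronglyMeasurable (by fun_prop))
    (Filter.Eventually.of_forall fun ω => ?_)
  rw [Real.norm_of_nonneg (Real.exp_pos _).le, Real.exp_le_one_iff]
  have : 0 ≤ q * C.τ i ω := by positivity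
  linarith

end Integrability

/-! ### Weak duality. -/

/-- The Fenchel inequality for `Fstar` at `y = u x`, after writing `exp (-r s)` as `exp (-ρ s) exp
((ρ - r) s)`. -/
lemma discounted_payment_le {κ : ℝ} (hκ : 0 ≤ κ) {l : ℝ} (hl : l ≤ 0) {x : ℝ} (hx : 0 ≤ x)
    (s : ℝ) :
    -(Real.exp (-M.ρ * s) * ((1 + κ) * x)) - l * (Real.exp (-M.r * s) * M.u x)
      ≤ -(Real.exp (-M.ρ * s) * M.Fstar κ (l * Real.exp ((M.ρ - M.r) * s))) := by
  have h := M.Fstar_le hκ (mul_nonpos_of_nonpos_of_nonneg hl (Real.exp_pos _).le :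
    l * Real.exp ((M.ρ - M.r) * s) ≤ 0) (M.u_nonneg hx)
  rw [M.u_rpow hx] at h
  have h2 := mul_le_mul_of_nonneg_left h (Real.exp_pos (-M.ρ * s)).le
  have h3 : Real.exp (-M.r * s) = Real.exp (-M.ρ * s) * Real.exp ((M.ρ - M.r) * s) := by
    rw [← Real.exp_add]
    ring_nf
  rw [h3]
  linarith

lemma running_gain_le {l : ℝ} (t : ℝ) {a : ℝ} (ha : a ∈ Icc 0 M.abar) :
    M.ρ * Real.exp (-M.ρ * t) * a - l * (-(M.r * Real.exp (-M.r * t) * M.h a))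
      ≤ M.ρ * Real.exp (-M.ρ * t) * M.Gstar (M.δ * l * Real.exp ((M.ρ - M.r) * t)) := by
  have h := mul_le_mul_of_nonneg_left
    (M.le_Gstar (M.δ * l * Real.exp ((M.ρ - M.r) * t)) ha)
    (mul_pos M.ρ_pos (Real.exp_pos (-M.ρ * t))).le
  have h3 : M.r * Real.exp (-M.r * t)
      = M.ρ * Real.exp (-M.ρ * t) * (M.δ * Real.exp ((M.ρ - M.r) * t)) := by
    rw [show -M.r * t = -M.ρ * t + (M.ρ - M.r) * t by ring, Real.exp_add, δ]
    field_simp [M.ρ_pos.ne']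
  rw [h3]
  linarith

/-- Weak duality: every multiplier bounds the principal's value from above. -/
lemma VFB_le {R l B : ℝ} (hl : l ≤ 0)
    (hB : ∀ s : ℝ, 0 ≤ s → s ≤ M.T → M.bonus s l ≤ B) :
    M.VFB R ≤ ((l * M.u R + M.N * B
      - Real.exp (-M.ρ * M.T) * M.Fstar 0 (l * Real.exp ((M.ρ - M.r) * M.T))
      + ∫ t in (0 : ℝ)..M.T, M.ρ * Real.exp (-M.ρ * t) *
          M.Gstar (M.δ * l * Real.exp ((M.ρ - M.r) * t)) : ℝ) : EReal) := by
  refine sSup_le ?_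
  rintro _ ⟨C, α, Q, hC, hα, hQ, hJA, rfl⟩
  rw [EReal.coe_le_coe_iff]
  have := hQ.isProb
  have hN : 0 < M.N := M.one_le_N
  have hξ := hC.integrable_ξ hα hQ
  have hξT := (hξ ⟨0, hN⟩).2
  have hcost := hα.integrable_cost (Q := Q)
  have hout := hα.integrable_output (Q := Q)
  have hIA : Integrable (fun ω => (∑ i, Real.exp (-M.r * C.τ i ω) * M.u (C.ξ i ω))
      + Real.exp (-M.r * M.T) * M.u (C.ξT ω)
      - ∫ t in (0 : ℝ)..M.T, M.r * Real.exp (-M.r * t) * M.h (α t.toNNReal ω)) Q :=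
    ((integrable_finsetSum _ fun i _ =>
      hC.integrable_discounted M.r_pos.le i (hξ i).1.2).add (hξT.2.const_mul _)).sub hcost.1
  have hIP : Integrable (fun ω => -(∑ i, Real.exp (-M.ρ * C.τ i ω) * ((1 + M.k) * C.ξ i ω))
      - Real.exp (-M.ρ * M.T) * C.ξT ω
      + ∫ t in (0 : ℝ)..M.T, M.ρ * Real.exp (-M.ρ * t) * α t.toNNReal ω) Q :=
    ((integrable_finsetSum _ fun i _ =>
      hC.integrable_discounted M.ρ_pos.le i ((hξ i).1.1.const_mul _)).neg.sub
        (hξT.1.const_mul _)).add hout.1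
  -- The Lagrangian is bounded path by path by a constant free of contract, effort and measure.
  -- Random payment times are harmless because `B` dominates the bonus at every time in `[0, T]`.
  have hpt : ∀ ω, (-(∑ i, Real.exp (-M.ρ * C.τ i ω) * ((1 + M.k) * C.ξ i ω))
      - Real.exp (-M.ρ * M.T) * C.ξT ω
      + ∫ t in (0 : ℝ)..M.T, M.ρ * Real.exp (-M.ρ * t) * α t.toNNReal ω)
      - l * ((∑ i, Real.exp (-M.r * C.τ i ω) * M.u (C.ξ i ω))
      + Real.exp (-M.r * M.T) * M.u (C.ξT ω)
      - ∫ t in (0 : ℝ)..M.T, M.r * Real.exp (-M.r * t) * M.h (α t.toNNReal ω))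
      ≤ M.N * B - Real.exp (-M.ρ * M.T) * M.Fstar 0 (l * Real.exp ((M.ρ - M.r) * M.T))
      + ∫ t in (0 : ℝ)..M.T, M.ρ * Real.exp (-M.ρ * t) *
          M.Gstar (M.δ * l * Real.exp ((M.ρ - M.r) * t)) := by
    intro ω
    have h1 : -(∑ i, Real.exp (-M.ρ * C.τ i ω) * ((1 + M.k) * C.ξ i ω))
        - l * (∑ i, Real.exp (-M.r * C.τ i ω) * M.u (C.ξ i ω)) ≤ M.N * B := by
      rw [Finset.mul_sum, ← Finset.sum_neg_distrib, ← Finset.sum_sub_distrib]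
      calc _ ≤ ∑ _i : Fin M.N, B := Finset.sum_le_sum fun i _ =>
            (M.discounted_payment_le M.k_pos.le hl (hC.ξ_nonneg i ω) _).trans
              (hB _ (C.τ i ω).coe_nonneg (hC.lt_T i ω).le)
        _ = M.N * B := by simp
    have h2 := M.discounted_payment_le le_rfl hl (hC.ξT_nonneg ω) M.T
    have h3 : (∫ t in (0 : ℝ)..M.T, M.ρ * Real.exp (-M.ρ * t) * α t.toNNReal ω)
        - l * (-∫ t in (0 : ℝ)..M.T, M.r * Real.exp (-M.r * t) * M.h (α t.toNNReal ω))
        ≤ ∫ t in (0 : ℝ)..M.T, M.ρ * Real.exp (-M.ρ * t) *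
          M.Gstar (M.δ * l * Real.exp ((M.ρ - M.r) * t)) := by
      have hneg : IntervalIntegrable
          (fun t => l * -(M.r * Real.exp (-M.r * t) * M.h (α t.toNNReal ω))) volume 0 M.T :=
        (hcost.2 ω).neg.const_mul l
      rw [← intervalIntegral.integral_neg, ← intervalIntegral.integral_const_mul,
        ← intervalIntegral.integral_sub (hout.2 ω) hneg]
      refine intervalIntegral.integral_mono_on M.T.coe_nonneg
        ((hout.2 ω).sub hneg)
        ((M.continuous_Gstar_integrand hl).intervalIntegrable _ _) fun t _ => ?_
      exact M.running_gain_le t (hα.2 _ _)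
    simp only [add_zero, one_mul] at h2
    linarith
  have hle := integral_mono (hIP.sub (hIA.const_mul l)) (integrable_const (μ := Q) _) hpt
  simp only [integral_const, probReal_univ, one_smul] at hle
  have heq : ∫ ω, ((-(∑ i, Real.exp (-M.ρ * C.τ i ω) * ((1 + M.k) * C.ξ i ω))
      - Real.exp (-M.ρ * M.T) * C.ξT ω
      + ∫ t in (0 : ℝ)..M.T, M.ρ * Real.exp (-M.ρ * t) * α t.toNNReal ω)
      - l * ((∑ i, Real.exp (-M.r * C.τ i ω) * M.u (C.ξ i ω))
      + Real.exp (-M.r * M.T) * M.u (C.ξT ω)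
      - ∫ t in (0 : ℝ)..M.T, M.r * Real.exp (-M.r * t) * M.h (α t.toNNReal ω))) ∂Q
      = M.JP C α Q - l * M.JA C α Q := by
    rw [integral_sub hIP (hIA.const_mul l), integral_const_mul, JP, JA]
  have hle' := heq ▸ hle
  have := mul_le_mul_of_nonpos_left hJA hl
  linarith

end PAModel

/-! ### Strong duality for deterministic payment dates. -/

lemma integral_discount (q T : ℝ) :
    ∫ t in (0 : ℝ)..T, q * Real.exp (-q * t) = 1 - Real.exp (-q * T) := by
  have h : ∀ t ∈ uIcc 0 T, HasDerivAt (fun t => -Real.exp (-q * t)) (q * Real.exp (-q * t)) t := by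
    intro t _
    have h1 : HasDerivAt (fun t => -q * t) (-q) t := by
      simpa using (hasDerivAt_id t).const_mul (-q)
    exact h1.exp.neg.congr_deriv (by ring)
  rw [intervalIntegral.integral_eq_sub_of_hasDerivAt h
    (Continuous.intervalIntegrable (by fun_prop) _ _), mul_zero, Real.exp_zero]
  ring

namespace PAModel

variable {Ω : Type*} [m : MeasurableSpace Ω] (M : PAModel Ω)

lemma u_of_rpow {y : ℝ} (hy : 0 ≤ y) : M.u (y ^ M.γ) = y := by
  rw [u, ← Real.rpow_mul hy, mul_one_div_cancel M.γ_pos.ne', Real.rpow_one]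

/-- The contract that delivers the utilities `y i` at times `s i` and `yT` at the horizon. -/
noncomputable def detContract (s : Fin M.N → ℝ≥0) (y : Fin M.N → ℝ) (yT : ℝ) :
    Contract M.N Ω where
  τ i _ := s i
  ξ i _ := y i ^ M.γ
  ξT _ := yT ^ M.γ

lemma admissible_detContract {s : Fin M.N → ℝ≥0} (hs : Monotone s) (hsT : ∀ i, s i < M.T)
    {y : Fin M.N → ℝ} (hy : ∀ i, 0 ≤ y i) {yT : ℝ} (hyT : 0 ≤ yT) :
    M.Admissible (M.detContract s y yT) where
  stopping i := isStoppingTime_const _ (s i)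
  lt_T i _ := hsT i
  increasing _ := hs
  ξ_nonneg i _ := Real.rpow_nonneg (hy i) _
  ξ_meas i := measurable_const
  ξT_nonneg _ := Real.rpow_nonneg hyT _
  ξT_meas := measurable_const
  integrability := by
    refine lt_of_le_of_lt (b := ∑ i, (ENNReal.ofReal (|y i ^ M.γ| ^ M.γ)
      + ENNReal.ofReal (|yT ^ M.γ| ^ M.γ))) ?_ ?_
    · refine iSup_le fun i => iSup_le fun α => iSup_le fun Q => iSup_le fun _ =>
        iSup_le fun hQ => ?_
      have := hQ.isProb
      simp only [detContract, lintegral_const, measure_univ, mul_one]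
      exact Finset.single_le_sum (f := fun i => ENNReal.ofReal (|y i ^ M.γ| ^ M.γ)
        + ENNReal.ofReal (|yT ^ M.γ| ^ M.γ)) (fun _ _ => zero_le) (Finset.mem_univ i)
    · exact ENNReal.sum_lt_top.2 fun i _ => by simp

/-- All payoffs are deterministic, so `Q` has no effect on their values and only certifies that the
effort is feasible. -/
lemma le_VFB_of_deterministic {R : ℝ} {s : Fin M.N → ℝ≥0} (hs : Monotone s)
    (hsT : ∀ i, s i < M.T) {y : Fin M.N → ℝ} (hy : ∀ i, 0 ≤ y i) {yT : ℝ} (hyT : 0 ≤ yT)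
    {a : ℝ≥0 → ℝ} {Q : Measure Ω} (ha : M.Effort fun t _ => a t)
    (hQ : M.IsEffortMeasure (fun t _ => a t) Q)
    (hR : M.u R ≤ (∑ i, Real.exp (-M.r * s i) * y i) + Real.exp (-M.r * M.T) * yT
      - ∫ t in (0 : ℝ)..M.T, M.r * Real.exp (-M.r * t) * M.h (a t.toNNReal)) :
    ((-(∑ i, Real.exp (-M.ρ * s i) * ((1 + M.k) * y i ^ M.γ))
      - Real.exp (-M.ρ * M.T) * yT ^ M.γ
      + ∫ t in (0 : ℝ)..M.T, M.ρ * Real.exp (-M.ρ * t) * a t.toNNReal : ℝ) : EReal)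
      ≤ M.VFB R := by
  have := hQ.isProb
  refine le_sSup ⟨M.detContract s y yT, fun t _ => a t, Q,
    M.admissible_detContract hs hsT hy hyT, ha, hQ, ?_, ?_⟩
  · simpa [JA, detContract, M.u_of_rpow (hy _), M.u_of_rpow hyT] using hR
  · simp [JP, detContract]

/-- The agent's payoff, net of reservation utility, at the optimizers for the multiplier `l`. -/
noncomputable def slack (R : ℝ) (s : Fin M.N → ℝ≥0) (l : ℝ) : ℝ :=
  (∑ i, Real.exp (-M.r * s i) * M.yopt M.k (l * Real.exp ((M.ρ - M.r) * s i)))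
    + Real.exp (-M.r * M.T) * M.yopt 0 (l * Real.exp ((M.ρ - M.r) * M.T))
    - (∫ t in (0 : ℝ)..M.T, M.r * Real.exp (-M.r * t) *
        M.h (M.aopt (M.δ * l * Real.exp ((M.ρ - M.r) * t)))) - M.u R

lemma continuous_slack (R : ℝ) (s : Fin M.N → ℝ≥0) : Continuous (M.slack R s) := by
  have h1 := M.continuous_yopt
  have h2 := M.continuous_h_aopt
  unfold slack
  refine Continuous.sub (Continuous.sub (Continuous.add ?_ ?_) ?_) continuous_const
  · refine continuous_finsetSum _ fun i _ => continuous_const.mul ((h1 _).comp (by fun_prop))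
  · exact continuous_const.mul ((h1 _).comp (by fun_prop))
  · refine intervalIntegral.continuous_parametric_intervalIntegral_of_continuous' ?_ _ _
    have h3 : Continuous fun x : ℝ × ℝ => M.δ * x.1 * Real.exp ((M.ρ - M.r) * x.2) := by
      fun_prop
    exact (by fun_prop : Continuous fun x : ℝ × ℝ => M.r * Real.exp (-M.r * x.2)).mul
      (h2.comp h3)

/-- Intermediate value theorem. At `l = 0` nothing is paid while effort costs something nonnegative;
as `l → -∞` the terminal utility is unbounded while the cost stays below `h abar * (1 - exp (-r
T))`. -/
lemma exists_slack_eq_zero {R : ℝ} (hR : 0 ≤ R) (s : Fin M.N → ℝ≥0) :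
    ∃ l ≤ 0, M.slack R s l = 0 := by
  have hr := M.r_pos
  have hT : (0 : ℝ) ≤ M.T := M.T.coe_nonneg
  have hy0 : ∀ κ, M.yopt κ 0 = 0 := fun κ => by
    have : 1 / (M.γ - 1) ≠ 0 := by
      have := M.one_lt_γ
      exact one_div_ne_zero (by linarith)
    rw [yopt, neg_zero, max_self, zero_div, Real.zero_rpow this]
  have h0 : M.slack R s 0 ≤ 0 := by
    have h1 : 0 ≤ ∫ t in (0 : ℝ)..M.T, M.r * Real.exp (-M.r * t) *
        M.h (M.aopt (M.δ * 0 * Real.exp ((M.ρ - M.r) * t))) :=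
      intervalIntegral.integral_nonneg hT fun t _ =>
        mul_nonneg (by positivity) (M.h_nonneg (Subtype.prop (M.aopt _)).1)
    have h2 := M.u_nonneg hR
    rw [slack]
    simp only [zero_mul, hy0, mul_zero, Finset.sum_const_zero, add_zero, zero_sub] at h1 ⊢
    linarith
  have hlarge : Filter.Tendsto (fun x : ℝ => Real.exp (-M.r * M.T) *
      M.yopt 0 (-x * Real.exp ((M.ρ - M.r) * M.T))) Filter.atTop Filter.atTop := by
    refine Filter.Tendsto.const_mul_atTop (Real.exp_pos _) ?_
    have hexp : 0 < 1 / (M.γ - 1) := one_div_pos.2 (by linarith [M.one_lt_γ])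
    refine (tendsto_rpow_atTop hexp).comp ?_
    have hc : 0 < Real.exp ((M.ρ - M.r) * M.T) / ((1 + 0) * M.γ) := by
      have := M.γ_pos
      positivity
    refine Filter.tendsto_atTop_mono (fun x => ?_) (Filter.tendsto_id.const_mul_atTop hc)
    rw [id, div_mul_eq_mul_div]
    refine div_le_div_of_nonneg_right (le_max_of_le_left (le_of_eq (by ring))) ?_
    have := M.γ_pos
    positivity
  obtain ⟨x, hx, hx0⟩ := ((hlarge.eventually_ge_atTop (M.h M.abar * (1 - Real.exp (-M.r * M.T))
    + M.u R)).and (Filter.eventually_ge_atTop 0)).exists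
  have h1 : 0 ≤ M.slack R s (-x) := by
    have h2 : ∫ t in (0 : ℝ)..M.T, M.r * Real.exp (-M.r * t) *
        M.h (M.aopt (M.δ * -x * Real.exp ((M.ρ - M.r) * t)))
        ≤ M.h M.abar * (1 - Real.exp (-M.r * M.T)) := by
      rw [← integral_discount, mul_comm (M.h M.abar), ← intervalIntegral.integral_mul_const]
      refine intervalIntegral.integral_mono_on hT ?_
        (Continuous.intervalIntegrable (by fun_prop) _ _) fun t _ => ?_
      · refine Continuous.intervalIntegrable (Continuous.mul (by fun_prop) ?_) _ _
        exact M.continuous_h_aopt.comp (by fun_prop)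
      · refine mul_le_mul_of_nonneg_left ?_ (by positivity)
        exact M.h_mono (mem_Ici.2 (Subtype.prop (M.aopt _)).1) (mem_Ici.2 M.abar_pos.le)
          (Subtype.prop (M.aopt _)).2
    have h3 : 0 ≤ ∑ i, Real.exp (-M.r * s i) *
        M.yopt M.k (-x * Real.exp ((M.ρ - M.r) * s i)) :=
      Finset.sum_nonneg fun i _ => mul_nonneg (Real.exp_pos _).le (M.yopt_nonneg M.k_pos.le _)
    rw [slack]
    linarith
  obtain ⟨l, hl, hl'⟩ := intermediate_value_Icc' (by linarith : -x ≤ 0)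
    (M.continuous_slack R s).continuousOn ⟨h0, h1⟩
  exact ⟨l, hl.2, hl'⟩

/-- At a multiplier with zero slack, the dual function is the principal's payoff. -/
lemma dual_eq_of_slack_eq_zero {R : ℝ} {s : Fin M.N → ℝ≥0} {l : ℝ} (hl : l ≤ 0)
    (h : M.slack R s l = 0) :
    l * M.u R + (∑ i, M.bonus (s i) l)
      - Real.exp (-M.ρ * M.T) * M.Fstar 0 (l * Real.exp ((M.ρ - M.r) * M.T))
      + ∫ t in (0 : ℝ)..M.T, M.ρ * Real.exp (-M.ρ * t) *
          M.Gstar (M.δ * l * Real.exp ((M.ρ - M.r) * t))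
    = -(∑ i, Real.exp (-M.ρ * s i) *
          ((1 + M.k) * M.yopt M.k (l * Real.exp ((M.ρ - M.r) * s i)) ^ M.γ))
      - Real.exp (-M.ρ * M.T) * M.yopt 0 (l * Real.exp ((M.ρ - M.r) * M.T)) ^ M.γ
      + ∫ t in (0 : ℝ)..M.T, M.ρ * Real.exp (-M.ρ * t) *
          M.aopt (M.δ * l * Real.exp ((M.ρ - M.r) * t)) := by
  have hexp : ∀ x : ℝ, l * Real.exp x ≤ 0 := fun x =>
    mul_nonpos_of_nonpos_of_nonneg hl (Real.exp_pos _).le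
  have hdisc : ∀ x : ℝ, Real.exp (-M.ρ * x) * Real.exp ((M.ρ - M.r) * x)
      = Real.exp (-M.r * x) := fun x => by
    rw [← Real.exp_add]
    ring_nf
  have hpay : ∀ κ, 0 ≤ κ → ∀ x : ℝ,
      Real.exp (-M.ρ * x) * M.Fstar κ (l * Real.exp ((M.ρ - M.r) * x))
        = l * (Real.exp (-M.r * x) * M.yopt κ (l * Real.exp ((M.ρ - M.r) * x)))
          + Real.exp (-M.ρ * x) *
            ((1 + κ) * M.yopt κ (l * Real.exp ((M.ρ - M.r) * x)) ^ M.γ) := by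
    intro κ hκ x
    rw [M.Fstar_eq_yopt hκ (hexp _), ← hdisc]
    ring
  have hrun : ∀ t : ℝ, M.ρ * Real.exp (-M.ρ * t) *
        M.Gstar (M.δ * l * Real.exp ((M.ρ - M.r) * t))
      = M.ρ * Real.exp (-M.ρ * t) * M.aopt (M.δ * l * Real.exp ((M.ρ - M.r) * t))
        + l * (M.r * Real.exp (-M.r * t) *
          M.h (M.aopt (M.δ * l * Real.exp ((M.ρ - M.r) * t)))) := by
    intro t
    rw [M.Gstar_eq (M.δ_mul_exp_nonpos hl _), ← hdisc,
      show M.r = M.ρ * M.δ by rw [δ]; field_simp [M.ρ_pos.ne']]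
    ring
  have hc : Continuous fun t : ℝ => M.δ * l * Real.exp ((M.ρ - M.r) * t) := by fun_prop
  have hint : ∫ t in (0 : ℝ)..M.T, M.ρ * Real.exp (-M.ρ * t) *
          M.Gstar (M.δ * l * Real.exp ((M.ρ - M.r) * t))
      = (∫ t in (0 : ℝ)..M.T, M.ρ * Real.exp (-M.ρ * t) *
          M.aopt (M.δ * l * Real.exp ((M.ρ - M.r) * t)))
        + l * ∫ t in (0 : ℝ)..M.T, M.r * Real.exp (-M.r * t) *
          M.h (M.aopt (M.δ * l * Real.exp ((M.ρ - M.r) * t))) := by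
    simp_rw [hrun]
    rw [intervalIntegral.integral_add, intervalIntegral.integral_const_mul]
    · exact (Continuous.mul (by fun_prop) (continuous_subtype_val.comp
        (M.continuous_aopt.comp hc))).intervalIntegrable _ _
    · exact (continuous_const.mul (Continuous.mul (by fun_prop)
        (M.continuous_h_aopt.comp hc))).intervalIntegrable _ _
  have hsum : ∑ i, M.bonus (s i) l = -(l * ∑ i, Real.exp (-M.r * s i) *
        M.yopt M.k (l * Real.exp ((M.ρ - M.r) * s i)))
      - ∑ i, Real.exp (-M.ρ * s i) *
          ((1 + M.k) * M.yopt M.k (l * Real.exp ((M.ρ - M.r) * s i)) ^ M.γ) := by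
    simp_rw [bonus, hpay M.k M.k_pos.le]
    rw [Finset.mul_sum, ← Finset.sum_neg_distrib, ← Finset.sum_sub_distrib]
    exact Finset.sum_congr rfl fun i _ => by ring
  rw [hint, hsum, hpay 0 le_rfl]
  -- The two sides differ by exactly `-l * slack`, which is complementary slackness.
  have h' := congrArg (fun x => l * x) h
  simp only [slack, mul_zero] at h'
  linear_combination (-1 : ℝ) * h'

/-- Strong duality for deterministic payment times. -/
lemma dualInf_le_VFB {R : ℝ} (hR : 0 ≤ R) {s : Fin M.N → ℝ≥0} (hs : Monotone s)
    (hsT : ∀ i, s i < M.T) :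
    M.dualInf R (fun l => ∑ i, M.bonus (s i) l) ≤ M.VFB R := by
  obtain ⟨l, hl, hslack⟩ := M.exists_slack_eq_zero hR s
  refine (iInf₂_le l hl).trans ?_
  rw [M.dual_eq_of_slack_eq_zero hl hslack]
  set f : ℝ → ℝ := fun t => M.aopt (M.δ * l * Real.exp ((M.ρ - M.r) * t)) with hfdef
  set y : Fin M.N → ℝ := fun i => M.yopt M.k (l * Real.exp ((M.ρ - M.r) * s i)) with hydef
  set yT : ℝ := M.yopt 0 (l * Real.exp ((M.ρ - M.r) * M.T)) with hyTdef
  have hc : Continuous fun t : ℝ => M.δ * l * Real.exp ((M.ρ - M.r) * t) := by fun_prop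
  have hf : Continuous f := continuous_subtype_val.comp (M.continuous_aopt.comp hc)
  have hhf : Continuous fun t => M.h (f t) := M.continuous_h_aopt.comp hc
  have hy : ∀ i, 0 ≤ y i := fun i => M.yopt_nonneg M.k_pos.le _
  have hyT : 0 ≤ yT := M.yopt_nonneg le_rfl _
  have hT : (0 : ℝ) ≤ M.T := M.T.coe_nonneg
  have hr := M.r_pos
  have hρ := M.ρ_pos
  -- A step effort loses at most `η` of output and costs the agent at most `η` more. Additional
  -- terminal utility `exp (r T) * η`, discounted to `η`, restores participation.
  have key : ∀ η : ℝ, 0 < η →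
      ((-(∑ i, Real.exp (-M.ρ * s i) * ((1 + M.k) * y i ^ M.γ))
        - Real.exp (-M.ρ * M.T) * (yT + Real.exp (M.r * M.T) * η) ^ M.γ
        + ((∫ t in (0 : ℝ)..M.T, M.ρ * Real.exp (-M.ρ * t) * f t) - η) : ℝ) : EReal)
        ≤ M.VFB R := by
    intro η hη
    obtain ⟨a, Q, ha, hQ, happ⟩ := M.exists_effort_approx hf
      (fun t => Subtype.prop (M.aopt _)) hη
    have := hQ.isProb
    have hω : Nonempty Ω := nonempty_of_isProbabilityMeasure Q
    obtain ⟨ω⟩ := hω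
    have hcost := (ha.integrable_cost (Q := Q)).2 ω
    have hout := (ha.integrable_output (Q := Q)).2 ω
    have hdisc : ∀ q : ℝ, 0 < q → ∫ t in (0 : ℝ)..M.T, q * Real.exp (-q * t) * η ≤ η := by
      intro q hq
      rw [intervalIntegral.integral_mul_const, integral_discount]
      nlinarith [Real.exp_pos (-q * M.T)]
    have hcle : ∫ t in (0 : ℝ)..M.T, M.r * Real.exp (-M.r * t) * M.h (a t.toNNReal)
        ≤ (∫ t in (0 : ℝ)..M.T, M.r * Real.exp (-M.r * t) * M.h (f t)) + η := by
      have hi : IntervalIntegrable (fun t => M.r * Real.exp (-M.r * t) * M.h (f t))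
          volume 0 M.T := (Continuous.mul (by fun_prop) hhf).intervalIntegrable _ _
      have hi' : IntervalIntegrable (fun t => M.r * Real.exp (-M.r * t) * η)
          volume 0 M.T := Continuous.intervalIntegrable (by fun_prop) _ _
      refine le_trans ?_ (add_le_add_right (hdisc M.r hr) _)
      rw [← intervalIntegral.integral_add hi hi']
      refine intervalIntegral.integral_mono_on_of_le_Ioo hT hcost (hi.add hi') fun t ht => ?_
      have h1 := (abs_le.1 (happ t ⟨ht.1, ht.2.le⟩).2).2
      rw [← mul_add]
      exact mul_le_mul_of_nonneg_left (by linarith) (by positivity)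
    have hole : (∫ t in (0 : ℝ)..M.T, M.ρ * Real.exp (-M.ρ * t) * f t)
        ≤ (∫ t in (0 : ℝ)..M.T, M.ρ * Real.exp (-M.ρ * t) * a t.toNNReal) + η := by
      have hi : IntervalIntegrable (fun t => M.ρ * Real.exp (-M.ρ * t) * f t)
          volume 0 M.T := (Continuous.mul (by fun_prop) hf).intervalIntegrable _ _
      have hi' : IntervalIntegrable (fun t => M.ρ * Real.exp (-M.ρ * t) * η)
          volume 0 M.T := Continuous.intervalIntegrable (by fun_prop) _ _
      refine le_trans ?_ (add_le_add_right (hdisc M.ρ hρ) _)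
      rw [← intervalIntegral.integral_add hout hi']
      refine intervalIntegral.integral_mono_on_of_le_Ioo hT hi (hout.add hi') fun t ht => ?_
      have h1 := (abs_le.1 (happ t ⟨ht.1, ht.2.le⟩).1).1
      rw [← mul_add]
      exact mul_le_mul_of_nonneg_left (by linarith) (by positivity)
    refine le_trans ?_ (M.le_VFB_of_deterministic (R := R) hs hsT hy
      (yT := yT + Real.exp (M.r * M.T) * η) (by positivity) ha hQ ?_)
    · rw [EReal.coe_le_coe_iff]
      linarith
    · have h1 : M.slack R s l = (∑ i, Real.exp (-M.r * s i) * y i)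
          + Real.exp (-M.r * M.T) * yT
          - (∫ t in (0 : ℝ)..M.T, M.r * Real.exp (-M.r * t) * M.h (f t)) - M.u R := rfl
      have h2 : Real.exp (-M.r * M.T) * (Real.exp (M.r * M.T) * η) = η := by
        rw [← mul_assoc, ← Real.exp_add]
        simp
      rw [mul_add, h2]
      linarith
  -- The bound is continuous in `η`, so letting `η ↓ 0` recovers the dual value.
  have hcont : Continuous fun η : ℝ =>
      (-(∑ i, Real.exp (-M.ρ * s i) * ((1 + M.k) * y i ^ M.γ))
        - Real.exp (-M.ρ * M.T) * (yT + Real.exp (M.r * M.T) * η) ^ M.γ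
        + ((∫ t in (0 : ℝ)..M.T, M.ρ * Real.exp (-M.ρ * t) * f t) - η) : ℝ) := by
    have : Continuous fun η : ℝ => (yT + Real.exp (M.r * M.T) * η) ^ M.γ :=
      (by fun_prop : Continuous fun η : ℝ => yT + Real.exp (M.r * M.T) * η).rpow_const
        fun _ => Or.inr M.γ_pos.le
    fun_prop
  have hlim := ((continuous_coe_real_ereal.comp hcont).tendsto 0).mono_left
    (nhdsWithin_le_nhds (s := Ioi (0 : ℝ)))
  have := le_of_tendsto hlim (eventually_nhdsWithin_of_forall fun η hη => key η hη)
  simpa using this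

end PAModel

/-! ### Comparison of payment dates, and strict bounds for `R = 0`. -/

lemma eventually_mul_rpow_lt {p : ℝ} (hp : 1 < p) (A : ℝ) {c : ℝ} (hc : 0 < c) :
    ∀ᶠ x : ℝ in nhdsWithin 0 (Ioi 0), A * x ^ p < c * x := by
  have hcont : Continuous fun x : ℝ => A * x ^ (p - 1) :=
    continuous_const.mul (continuous_id.rpow_const fun _ => Or.inr (by linarith))
  have h0 : A * (0 : ℝ) ^ (p - 1) < c := by
    rw [Real.zero_rpow (by linarith), mul_zero]
    exact hc
  have hev : ∀ᶠ x : ℝ in nhdsWithin 0 (Ioi 0), A * x ^ (p - 1) < c :=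
    nhdsWithin_le_nhds (hcont.tendsto 0 |>.eventually_lt_const h0)
  filter_upwards [hev, self_mem_nhdsWithin] with x hx hx0
  have hx0 : 0 < x := hx0
  rw [Real.rpow_sub_one hx0.ne', ← mul_div_assoc, div_lt_iff₀ hx0] at hx
  exact hx

lemma sum_Icc_one_eq_sum_range (f : ℕ → ℝ) (n : ℕ) :
    ∑ i ∈ Finset.Icc 1 n, f i = ∑ i ∈ Finset.range n, f (i + 1) := by
  induction n with
  | zero => simp
  | succ n ih => rw [Finset.sum_Icc_succ_top (by omega), ih, Finset.sum_range_succ]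

namespace PAModel

variable {Ω : Type*} [m : MeasurableSpace Ω] (M : PAModel Ω)

lemma h_pos {a : ℝ} (ha : 0 < a) : 0 < M.h a := by
  have h1 := M.h_strictConvex.2 (mem_Ici.2 le_rfl) (mem_Ici.2 ha.le) ha.ne
    (by norm_num : (0 : ℝ) < 1 / 2) (by norm_num : (0 : ℝ) < 1 / 2) (by norm_num)
  simp only [smul_eq_mul, mul_zero, zero_add, M.h_zero] at h1
  have h2 := M.h_nonneg (by positivity : 0 ≤ 1 / 2 * a)
  linarith

lemma h_le_mul {a : ℝ} (ha : a ∈ Icc 0 M.abar) : M.h a ≤ M.h M.abar / M.abar * a := by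
  have hb := M.abar_pos
  have h1 := M.h_strictConvex.convexOn.2 (mem_Ici.2 le_rfl) (mem_Ici.2 hb.le)
    (by rw [sub_nonneg, div_le_one hb]; exact ha.2 : 0 ≤ 1 - a / M.abar)
    (div_nonneg ha.1 hb.le) (by ring)
  simp only [smul_eq_mul, mul_zero, zero_add, M.h_zero, div_mul_cancel₀ _ hb.ne'] at h1
  calc M.h a ≤ a / M.abar * M.h M.abar := h1
    _ = M.h M.abar / M.abar * a := by ring

/-- Makes `Gstar` fall below `abar` linearly in `-p`: efforts above `abar / 2` cost at least `h
(abar / 2)`, and smaller ones already forgo `abar / 2` of output. -/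
lemma Gstar_le {p : ℝ} (hp : p ≤ 0) (hp' : -(M.h (M.abar / 2) * p) ≤ M.abar / 2) :
    M.Gstar p ≤ M.abar + M.h (M.abar / 2) * p := by
  have hb := M.abar_pos
  refine csSup_le ((nonempty_Icc.2 hb.le).image _) ?_
  rintro _ ⟨a, ha, rfl⟩
  simp only
  rcases le_total a (M.abar / 2) with h | h
  · have := mul_nonpos_of_nonneg_of_nonpos (M.h_nonneg ha.1) hp
    linarith
  · have h1 := M.h_mono (mem_Ici.2 (by positivity)) (mem_Ici.2 ha.1) h
    have := mul_le_mul_of_nonpos_right h1 hp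
    linarith [ha.2]

lemma bonusRate_neg (h : 1 < M.δ * M.γ) : M.bonusRate < 0 :=
  div_neg_of_neg_of_pos (mul_neg_of_pos_of_neg M.ρ_pos (by linarith)) (by linarith [M.one_lt_γ])

lemma bonusRate_nonneg (h : M.δ * M.γ ≤ 1) : 0 ≤ M.bonusRate :=
  div_nonneg (mul_nonneg M.ρ_pos.le (by linarith)) (by linarith [M.one_lt_γ])

lemma VFB_le_dualInf_of_one_lt (R : ℝ) (h : 1 < M.δ * M.γ) :
    M.VFB R ≤ M.dualInf R (fun l => -(M.N * M.Fstar M.k l)) := by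
  obtain ⟨c, hc, hb⟩ := M.exists_bonus_eq
  refine le_iInf₂ fun l hl => ?_
  have := M.VFB_le (R := R) (B := -M.Fstar M.k l) hl fun s hs _ => by
    rw [← M.bonus_zero, hb l hl, hb l hl]
    have : 0 ≤ (-l) ^ M.γconj := Real.rpow_nonneg (by linarith) _
    gcongr _ * Real.exp ?_
    nlinarith [M.bonusRate_neg h]
  rwa [mul_neg] at this

lemma VFB_le_dualInf_of_le_one (R : ℝ) (h : M.δ * M.γ ≤ 1) :
    M.VFB R ≤ M.dualInf R (fun l => -(M.N * Real.exp (-M.ρ * M.T) *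
      M.Fstar M.k (l * Real.exp ((M.ρ - M.r) * M.T)))) := by
  obtain ⟨c, hc, hb⟩ := M.exists_bonus_eq
  refine le_iInf₂ fun l hl => ?_
  have := M.VFB_le (R := R) (B := M.bonus M.T l) hl fun s _ hs => by
    rw [hb l hl, hb l hl]
    have : 0 ≤ (-l) ^ M.γconj := Real.rpow_nonneg (by linarith) _
    gcongr _ * Real.exp ?_
    exact mul_le_mul_of_nonneg_left hs (M.bonusRate_nonneg h)
  rwa [bonus, mul_neg, ← mul_assoc] at this

lemma N_pos : (0 : ℝ) < M.N := by exact_mod_cast M.one_le_N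

lemma dualInf_le_VFB_of_real {R : ℝ} (hR : 0 ≤ R) {s : Fin M.N → ℝ} (hs : Monotone s)
    (hs0 : ∀ i, 0 ≤ s i) (hsT : ∀ i, s i < M.T) :
    M.dualInf R (fun l => ∑ i, M.bonus (s i) l) ≤ M.VFB R := by
  have h := M.dualInf_le_VFB hR (s := fun i => (s i).toNNReal)
    (fun i j hij => Real.toNNReal_le_toNNReal (hs hij))
    (fun i => (Real.toNNReal_lt_iff_lt_coe (hs0 i)).2 (hsT i))
  simpa only [Real.coe_toNNReal _ (hs0 _)] using h

lemma dualInf_early_le_VFB {R : ℝ} (hR : 0 ≤ R) {ζ : ℝ} (hζ : 0 < ζ)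
    (hζT : ζ < (M.T : ℝ) / M.N) :
    M.dualInf R (fun l => ∑ i ∈ Finset.Icc 1 M.N, M.bonus (((i : ℝ) - 1) * ζ) l)
      ≤ M.VFB R := by
  rw [lt_div_iff₀ M.N_pos] at hζT
  have h := M.dualInf_le_VFB_of_real hR (s := fun i => ((i : ℕ) : ℝ) * ζ)
    (fun i j hij => mul_le_mul_of_nonneg_right (by exact_mod_cast hij) hζ.le)
    (fun i => by positivity)
    (fun i => by
      have : ((i : ℕ) : ℝ) ≤ M.N := by exact_mod_cast i.2.le
      calc ((i : ℕ) : ℝ) * ζ ≤ M.N * ζ := by gcongr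
        _ < M.T := by linarith)
  convert h using 3 with l
  rw [sum_Icc_one_eq_sum_range, Finset.sum_range]
  refine Finset.sum_congr rfl fun i _ => ?_
  push_cast
  rw [add_sub_cancel_right]

lemma dualInf_late_le_VFB {R : ℝ} (hR : 0 ≤ R) {ζ : ℝ} (hζ : 0 < ζ)
    (hζT : ζ < (M.T : ℝ) / M.N) :
    M.dualInf R (fun l => ∑ i ∈ Finset.Icc 1 M.N, M.bonus ((M.T : ℝ) - i * ζ) l)
      ≤ M.VFB R := by
  rw [lt_div_iff₀ M.N_pos] at hζT
  have h := M.dualInf_le_VFB_of_real hR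
    -- The dates `T - i ζ` decrease in `i`, whereas payment times must increase; the enumeration is
    -- reversed here and the sum reflected below.
    (s := fun i => (M.T : ℝ) - ((M.N : ℝ) - (i : ℕ)) * ζ)
    (fun i j hij => by
      have h1 : ((i : ℕ) : ℝ) ≤ (j : ℕ) := by exact_mod_cast hij
      have h2 := mul_le_mul_of_nonneg_right h1 hζ.le
      dsimp only
      linarith)
    (fun i => by
      have : (0 : ℝ) ≤ (i : ℕ) * ζ := by positivity
      linarith)
    (fun i => by
      have h1 : ((i : ℕ) : ℝ) < M.N := by exact_mod_cast i.2
      have h2 := mul_lt_mul_of_pos_right h1 hζ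
      linarith)
  convert h using 3 with l
  rw [sum_Icc_one_eq_sum_range, ← Finset.sum_range_reflect, Finset.sum_range]
  refine Finset.sum_congr rfl fun i _ => ?_
  have h1 : M.N - 1 - (i : ℕ) + 1 = M.N - (i : ℕ) := by omega
  rw [h1, Nat.cast_sub i.2.le]

/-- The bonus rate vanishes, so a bonus is worth the same at every date. Any spacing below `T / N`
attains the upper bound; half of it is taken. -/
lemma dualInf_le_VFB_of_eq_one {R : ℝ} (hR : 0 ≤ R) (h : M.δ * M.γ = 1) :
    M.dualInf R (fun l => -(M.N * Real.exp (-M.ρ * M.T) *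
      M.Fstar M.k (l * Real.exp ((M.ρ - M.r) * M.T)))) ≤ M.VFB R := by
  have hN := M.N_pos
  have hT : (0 : ℝ) < M.T := M.T_pos
  refine le_trans ?_ (M.dualInf_early_le_VFB hR (ζ := (M.T : ℝ) / M.N / 2) (by positivity)
    (half_lt_self (by positivity)))
  refine iInf₂_mono fun l hl => ?_
  obtain ⟨c, hc, hb⟩ := M.exists_bonus_eq
  have h0 : M.bonusRate = 0 := by simp [bonusRate, h]
  have h1 : ∀ s, M.bonus s l = M.bonus M.T l := fun s => by
    rw [hb l hl, hb l hl, h0, zero_mul, zero_mul]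
  rw [EReal.coe_le_coe_iff]
  simp only [h1, Finset.sum_const, Nat.card_Icc, add_tsub_cancel_right, nsmul_eq_mul]
  rw [bonus, mul_neg, ← mul_assoc]

/-- A small constant effort `a` with its cost reimbursed at `T` gains an amount linear in `a` and
costs the principal only `O(a^γ)`, with `γ > 1`. -/
lemma VFB_zero_pos : 0 < M.VFB 0 := by
  have hb := M.abar_pos
  have hT : (0 : ℝ) < M.T := M.T_pos
  have hr := M.r_pos
  have hρ := M.ρ_pos
  have hhb := M.h_pos hb
  have hexp : ∀ q : ℝ, 0 < q → Real.exp (-q * M.T) < 1 := fun q hq => by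
    rw [Real.exp_lt_one_iff]
    nlinarith
  have hc : 0 < 1 - Real.exp (-M.ρ * M.T) := by linarith [hexp M.ρ hρ]
  -- By convexity `h` lies below its chord on `[0, abar]`, so the terminal utility `exp (r T) * h a`
  -- is at most `K * a`.
  set K := Real.exp (M.r * M.T) * (M.h M.abar / M.abar) with hK
  have hK0 : 0 ≤ K := by positivity
  obtain ⟨a, ⟨ha1, ha0⟩, hab⟩ := (((eventually_mul_rpow_lt M.one_lt_γ
    (Real.exp (-M.ρ * M.T) * K ^ M.γ) hc).and self_mem_nhdsWithin).and
    (nhdsWithin_le_nhds (Iio_mem_nhds hb))).exists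
  have ha0 : 0 < a := ha0
  have hab : a < M.abar := hab
  set f : ℝ≥0 → ℝ := stepFun 1 (fun _ => a) (fun _ => 0) with hf
  have hf' : ∀ t : ℝ≥0, f t = a * if 0 < t then 1 else 0 := fun t => by simp [hf, stepFun]
  have hfpos : ∀ t : ℝ≥0, 0 < t → f t = a := fun t ht => by rw [hf', if_pos ht, mul_one]
  obtain ⟨Q, hQ⟩ := M.exists_isEffortMeasure_stepFun 1 (fun _ => a) (fun _ => 0)
    fun _ _ => zero_le
  have hE : M.Effort fun t _ => f t := by
    refine ⟨isStronglyPredictable_of_measurable _ (measurable_stepFun _ _ _), fun t _ => ?_⟩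
    simp only [hf']
    split_ifs
    · exact ⟨by linarith, by linarith⟩
    · exact ⟨by simp, by simpa using hb.le⟩
  have hint : ∀ (q : ℝ) (g : ℝ → ℝ), ∫ t in (0 : ℝ)..M.T, q * Real.exp (-q * t) *
      g (f t.toNNReal) = (1 - Real.exp (-q * M.T)) * g a := by
    intro q g
    rw [← integral_discount, ← intervalIntegral.integral_mul_const,
      intervalIntegral.integral_of_le hT.le, intervalIntegral.integral_of_le hT.le]
    refine setIntegral_congr_fun measurableSet_Ioc fun t ht => ?_
    simp only [hfpos _ (Real.toNNReal_pos.2 ht.1)]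
  have hha := M.h_nonneg ha0.le
  have hle := M.le_VFB_of_deterministic (R := 0)
    (s := fun _ => 0) monotone_const (fun _ => M.T_pos)
    (y := fun _ => 0) (fun _ => le_rfl) (yT := Real.exp (M.r * M.T) * M.h a) (by positivity)
    hE hQ (by
      have h1 : Real.exp (-M.r * M.T) * (Real.exp (M.r * M.T) * M.h a) = M.h a := by
        rw [← mul_assoc, ← Real.exp_add]
        simp
      have h2 : M.u 0 = 0 := Real.zero_rpow (one_div_ne_zero M.γ_pos.ne')
      rw [hint M.r M.h, h1, h2]
      have := mul_nonneg (Real.exp_pos (-M.r * M.T)).le hha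
      simp only [mul_zero, Finset.sum_const_zero]
      linarith)
  refine lt_of_lt_of_le ?_ hle
  rw [← EReal.coe_zero, EReal.coe_lt_coe_iff]
  have h3 : Real.exp (M.r * M.T) * M.h a ≤ K * a := by
    rw [hK, mul_assoc]
    exact mul_le_mul_of_nonneg_left (M.h_le_mul ⟨ha0.le, hab.le⟩) (Real.exp_pos _).le
  have h4 : (Real.exp (M.r * M.T) * M.h a) ^ M.γ ≤ K ^ M.γ * a ^ M.γ := by
    rw [← Real.mul_rpow hK0 ha0.le]
    exact Real.rpow_le_rpow (by positivity) h3 M.γ_pos.le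
  have h5 := mul_le_mul_of_nonneg_left h4 (Real.exp_pos (-M.ρ * M.T)).le
  have h6 := hint M.ρ fun x => x
  rw [h6, Real.zero_rpow M.γ_pos.ne']
  simp only [mul_zero, Finset.sum_const_zero]
  linarith

/-- Weak duality at a small multiplier `-x`: the effort term drops below `abar * (1 - exp (-ρ T))`
by an amount linear in `x`, while the payment terms are `O(x^γconj)` with `γconj > 1`. -/
lemma VFB_zero_lt :
    M.VFB 0 < ((M.abar * (1 - Real.exp (-M.ρ * M.T)) : ℝ) : EReal) := by
  have hb := M.abar_pos
  have hT : (0 : ℝ) < M.T := M.T_pos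
  have hρ := M.ρ_pos
  have hδ := M.δ_pos
  have hh := M.h_pos (half_pos hb)
  have hc : 0 < 1 - Real.exp (-M.ρ * M.T) := by
    rw [sub_pos, Real.exp_lt_one_iff]
    nlinarith
  obtain ⟨c, hc0, hbonus⟩ := M.exists_bonus_eq
  obtain ⟨d, hd0, hF⟩ := M.exists_Fstar_eq (le_refl (0 : ℝ))
  -- `E'` and `E` bound `exp ((ρ - r) t)` on `[0, T]` whatever the sign of `ρ - r`; likewise
  -- `|bonusRate|` below covers all cases of `δγ`.
  set E := Real.exp (|M.ρ - M.r| * M.T) with hE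
  set E' := Real.exp (-(|M.ρ - M.r| * M.T)) with hE'
  have hEpos : 0 < E := Real.exp_pos _
  have hE'pos : 0 < E' := Real.exp_pos _
  have hEbd : ∀ t ∈ Icc (0 : ℝ) M.T, E' ≤ Real.exp ((M.ρ - M.r) * t) ∧
      Real.exp ((M.ρ - M.r) * t) ≤ E := by
    intro t ht
    have h1 : |(M.ρ - M.r) * t| ≤ |M.ρ - M.r| * M.T := by
      rw [abs_mul, abs_of_nonneg ht.1]
      exact mul_le_mul_of_nonneg_left ht.2 (abs_nonneg _)
    exact ⟨Real.exp_le_exp.2 (abs_le.1 h1).1, Real.exp_le_exp.2 (abs_le.1 h1).2⟩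
  set A := M.N * (c * Real.exp (|M.bonusRate| * M.T))
    + Real.exp (-M.ρ * M.T) * (d * Real.exp ((M.ρ - M.r) * M.T) ^ M.γconj) with hA
  have hc' : 0 < (1 - Real.exp (-M.ρ * M.T)) * (M.h (M.abar / 2) * (M.δ * E')) := by positivity
  -- Below this threshold the smallness condition of `Gstar_le` holds at every `t` in `[0, T]`.
  have hsmall : 0 < M.abar / 2 / (M.h (M.abar / 2) * (M.δ * E)) := by positivity
  obtain ⟨x, ⟨hx1, hx0⟩, hx2⟩ := (((eventually_mul_rpow_lt M.one_lt_γconj A hc').and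
    self_mem_nhdsWithin).and (nhdsWithin_le_nhds (Iio_mem_nhds hsmall))).exists
  have hx0 : 0 < x := hx0
  have hx2 : x < M.abar / 2 / (M.h (M.abar / 2) * (M.δ * E)) := hx2
  rw [lt_div_iff₀ (by positivity)] at hx2
  have hl : -x ≤ 0 := by linarith
  have hxg : 0 ≤ x ^ M.γconj := Real.rpow_nonneg hx0.le _
  refine lt_of_le_of_lt (M.VFB_le (R := 0) (l := -x)
    (B := c * x ^ M.γconj * Real.exp (|M.bonusRate| * M.T)) hl fun s hs hsT => ?_) ?_
  · rw [hbonus _ hl, neg_neg]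
    gcongr
    exact le_abs_self _
  · rw [EReal.coe_lt_coe_iff]
    have hG : ∫ t in (0 : ℝ)..M.T, M.ρ * Real.exp (-M.ρ * t) *
          M.Gstar (M.δ * -x * Real.exp ((M.ρ - M.r) * t))
        ≤ (1 - Real.exp (-M.ρ * M.T)) * (M.abar - M.h (M.abar / 2) * (M.δ * E') * x) := by
      rw [← integral_discount, ← intervalIntegral.integral_mul_const]
      refine intervalIntegral.integral_mono_on hT.le
        ((M.continuous_Gstar_integrand hl).intervalIntegrable _ _)
        (Continuous.intervalIntegrable (by fun_prop) _ _) fun t ht => ?_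
      refine mul_le_mul_of_nonneg_left ?_ (by positivity)
      obtain ⟨h1, h2⟩ := hEbd t ht
      have hcoef : 0 ≤ M.h (M.abar / 2) * M.δ * x := by positivity
      have h3 := mul_le_mul_of_nonneg_left h1 hcoef
      have h4 := mul_le_mul_of_nonneg_left h2 hcoef
      refine (M.Gstar_le (M.δ_mul_exp_nonpos hl _) (by linarith)).trans (by linarith)
    have hu : M.u 0 = 0 := Real.zero_rpow (one_div_ne_zero M.γ_pos.ne')
    have hF' : M.Fstar 0 (-x * Real.exp ((M.ρ - M.r) * M.T))
        = -(d * (x ^ M.γconj * Real.exp ((M.ρ - M.r) * M.T) ^ M.γconj)) := by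
      rw [hF _ (mul_nonpos_of_nonpos_of_nonneg hl (Real.exp_pos _).le), neg_mul, neg_neg,
        Real.mul_rpow hx0.le (Real.exp_pos _).le]
    rw [hu, hF']
    have hA' : A * x ^ M.γconj = M.N * (c * x ^ M.γconj * Real.exp (|M.bonusRate| * M.T))
        + Real.exp (-M.ρ * M.T) *
          (d * (x ^ M.γconj * Real.exp ((M.ρ - M.r) * M.T) ^ M.γconj)) := by
      rw [hA]
      ring
    linarith

end PAModel

theorem mainTheorem1 {Ω : Type*} [MeasurableSpace Ω] (M : PAModel Ω) (R : ℝ) (hR : 0 ≤ R) :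
    (1 < M.δ * M.γ →
      (∀ ζ : ℝ, 0 < ζ → ζ < (M.T : ℝ) / M.N →
        M.dualInf R (fun l => ∑ i ∈ Finset.Icc 1 M.N, M.bonus (((i : ℝ) - 1) * ζ) l)
          ≤ M.VFB R) ∧
      M.VFB R ≤ M.dualInf R (fun l => -(M.N * M.Fstar M.k l))) ∧
    (M.δ * M.γ < 1 →
      (∀ ζ : ℝ, 0 < ζ → ζ < (M.T : ℝ) / M.N →
        M.dualInf R (fun l => ∑ i ∈ Finset.Icc 1 M.N, M.bonus ((M.T : ℝ) - i * ζ) l)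
          ≤ M.VFB R) ∧
      M.VFB R ≤ M.dualInf R (fun l =>
        -(M.N * Real.exp (-M.ρ * M.T) *
          M.Fstar M.k (l * Real.exp ((M.ρ - M.r) * M.T))))) ∧
    (M.δ * M.γ = 1 →
      M.VFB R = M.dualInf R (fun l =>
        -(M.N * Real.exp (-M.ρ * M.T) *
          M.Fstar M.k (l * Real.exp ((M.ρ - M.r) * M.T))))) ∧
    (R = 0 →
      0 < M.VFB R ∧ M.VFB R < ((M.abar * (1 - Real.exp (-M.ρ * M.T)) : ℝ) : EReal)) := by
  refine ⟨fun h => ⟨fun ζ h1 h2 => M.dualInf_early_le_VFB hR h1 h2,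
      M.VFB_le_dualInf_of_one_lt R h⟩,
    fun h => ⟨fun ζ h1 h2 => M.dualInf_late_le_VFB hR h1 h2, M.VFB_le_dualInf_of_le_one R h.le⟩,
    fun h => le_antisymm (M.VFB_le_dualInf_of_le_one R h.le) (M.dualInf_le_VFB_of_eq_one hR h),
    ?_⟩
  rintro rfl
  exact ⟨M.VFB_zero_pos, M.VFB_zero_lt⟩
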